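/- Let $d\ge 3$, $n=d-1$, and let $M$ be a compact connected smooth $d$-manifold with (possibly empty) boundary $\Sigma=\partial M$. All structures are smooth up to the boundary. Definitions. For a Riemannian metric $g$ let $P$ be the Schouten tensor, $\mathrm{Ric}=(d-2)P+Jg$ with $J=\mathrm{tr}_g P$, and let $\Delta=-\nabla^a\nabla_a$. On a conformal manifold $(M,[g])$ a standard tractor field $I$ is represented, for each metric $g$ in the class, by a triple $(\sigma,\mu_a,\rho)$ of sections of $\mathcal E[1]\oplus T^*M[1]\oplus\mathcal E[-1]$, and under $g\mapsto e^{2\omega}g$, with $\Upsilon=d\omega$, the triple becomes $(\sigma,\ \mu_b+\sigma\Upsilon_b,\ \rho-\boldsymbol g^{bc}\Upsilon_b\mu_c-\frac12\sigma\,\boldsymbol g^{bc}\Upsilon_b\Upsilon_c)$; here $\mathcal E[w]$ is the bundle of conformal densities of weight $w$ and $\boldsymbol g$ is the conformal metric. The tractor metric is $h(I,I)=\boldsymbol g^{-1}(\mu,\mu)+2\sigma\rho=:|I|^2$, the tractor connection is $$\nabla_a(\sigma,\mu_b,\rho)=(\nabla_a\sigma-\mu_a,\ \nabla_a\mu_b+\boldsymbol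 g_{ab}\rho+P_{ab}\sigma,\ \nabla_a\rho-P_{ab}\mu^b),$$ and the canonical tractor is $X=(0,0,1)$, so that $\sigma=h(X,I)$. The triple $(M,[g],I)$ is an almost Einstein structure if $I$ is parallel and $I\ne0$; its scale singularity set is the zero set of $\sigma$. It is scalar negative if $S(\sigma)=\frac2d\sigma(J-\Delta)\sigma-|\nabla\sigma|^2_{\boldsymbol g}<0$ on $M$. A metric $g^o$ on the interior of $M$ is conformally compact if there are a smooth function $s\ge0$ on $M$ with zero set $\Sigma$ and with $ds\neq0$ along $\Sigma$, and a Riemannian metric $g$ on $M$, such that $g=s^2g^o$ on the interior; we then say that $g$ is a conformal compactification of $g^o$ by $s$. If moreover $\mathrm{Ric}(g^o)=-n\,g^o$, then $(M,g^o)$ is Poincaré–Einstein. Proposition. (1) Let $(M,[g],I)$ be an almost Einstein structure with $|I|^2=1$ whose scale singularity set is $\Sigma$. Then $M$ with the interior metric $g^o=\sigma^{-2}\boldsymbol g$ is Poincaré–Einstein; moreover each metric $g$ of the class $[g]$ is a conformal compactification of $g^o$, by the function $|\sigma|$ (trivialised by $g$). (2) Conversely, let $(M,g^o)$ be Poincaré–Einstein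 and let $g$ be any conformal compactification of $g^o$. Then $(M,[g])$ carries a parallel tractor $I\neq0$ such that $(M,[g],I)$ is a scalar negative almost Einstein structure with $|I|^2=1$, with scale singularity set $\Sigma$, and with $\sigma^{-2}\boldsymbol g=g^o$ on the interior. -/

import Mathlib

open Set Manifold Bundle
open scoped ContDiff Topology

noncomputable section

namespace AlmostEinstein

/-!
Smooth manifolds with (possibly empty) boundary, of dimension `d`, are modelled on the Euclidean
half space through `𝓡∂ d`. Tensor fields are expressed in the coordinates of the charts
`extChartAt (𝓡∂ d) x₀`; a pair `(x₀, y)` with `y` in the target of this chart stands for the point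
with coordinates `y`. Partial derivatives at boundary points are one-sided, i.e. taken within the
half space `range (𝓡∂ d)`.
-/

section Fields

variable {d : ℕ} [NeZero d]
  {M : Type*} [TopologicalSpace M] [ChartedSpace (EuclideanHalfSpace d) M]

variable (d M) in
/-- Fields of bilinear forms on the tangent spaces, without any regularity. -/
abbrev BilinField : Type _ :=
  ∀ x : M, TangentSpace (𝓡∂ d) x →L[ℝ] TangentSpace (𝓡∂ d) x →L[ℝ] ℝ

variable (d M) in
/-- Fields of covectors, without any regularity. -/
abbrev CovectorField : Type _ := ∀ x : M, TangentSpace (𝓡∂ d) x →L[ℝ] ℝ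

/-- `g` is a smooth Riemannian metric on the set `U` (used for `U = M` and for `U` the interior of
`M`; the values of `g` outside `U` are irrelevant). -/
structure IsRiemannianMetricOn [IsManifold (𝓡∂ d) ∞ M] (g : BilinField d M) (U : Set M) :
    Prop where
  symm : ∀ x ∈ U, ∀ v w, g x v w = g x w v
  pos : ∀ x ∈ U, ∀ v, v ≠ 0 → 0 < g x v v
  smooth : ContMDiffOn (𝓡∂ d)
    ((𝓡∂ d).prod 𝓘(ℝ, EuclideanSpace ℝ (Fin d) →L[ℝ] EuclideanSpace ℝ (Fin d) →L[ℝ] ℝ)) ∞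
    (fun x ↦ TotalSpace.mk'
      (EuclideanSpace ℝ (Fin d) →L[ℝ] EuclideanSpace ℝ (Fin d) →L[ℝ] ℝ) x (g x)) U

/-- The differential of a function, as a field of covectors. -/
def differential (f : M → ℝ) : CovectorField d M := fun x ↦ mfderiv (𝓡∂ d) 𝓘(ℝ, ℝ) f x

/-- The pairing `g⁻¹(μ, ν)` of covectors: `B.inverse` is the index raising map, the inverse of
`v ↦ B v`. -/
def cometric {x : M} (B : TangentSpace (𝓡∂ d) x →L[ℝ] TangentSpace (𝓡∂ d) x →L[ℝ] ℝ)
    (μ ν : TangentSpace (𝓡∂ d) x →L[ℝ] ℝ) : ℝ :=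
  μ (ContinuousLinearMap.inverse B ν)

end Fields

section Coordinates

variable {d : ℕ} [NeZero d]
  {M : Type*} [TopologicalSpace M] [ChartedSpace (EuclideanHalfSpace d) M]

/-- The point with coordinates `y` in the chart at `x₀`. -/
def pt (x₀ : M) (y : EuclideanSpace ℝ (Fin d)) : M := (extChartAt (𝓡∂ d) x₀).symm y

/-- The coordinate vector field `∂ᵢ` of the chart at `x₀`. -/
def coordVec (x₀ : M) (y : EuclideanSpace ℝ (Fin d)) (i : Fin d) :
    TangentSpace (𝓡∂ d) (pt x₀ y) :=
  mfderivWithin 𝓘(ℝ, EuclideanSpace ℝ (Fin d)) (𝓡∂ d) (extChartAt (𝓡∂ d) x₀).symm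
    (range (𝓡∂ d)) y (EuclideanSpace.single i (1 : ℝ) : EuclideanSpace ℝ (Fin d))

/-- The partial derivative `∂ᵢ f` of a function of the coordinates. -/
def pderiv (i : Fin d) (f : EuclideanSpace ℝ (Fin d) → ℝ) (y : EuclideanSpace ℝ (Fin d)) : ℝ :=
  fderivWithin ℝ f (range (𝓡∂ d)) y (EuclideanSpace.single i (1 : ℝ))

variable (g : BilinField d M) (x₀ : M)

/-- The components `g_ij`. -/
def metricCoord (y : EuclideanSpace ℝ (Fin d)) : Matrix (Fin d) (Fin d) ℝ :=
  Matrix.of fun i j ↦ g (pt x₀ y) (coordVec x₀ y i) (coordVec x₀ y j)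

/-- The components `g^ij` of the inverse metric. -/
def invMetricCoord (y : EuclideanSpace ℝ (Fin d)) : Matrix (Fin d) (Fin d) ℝ :=
  (metricCoord g x₀ y)⁻¹

/-- The components `μ_i` of a covector field. -/
def covectorCoord (μ : CovectorField d M) (i : Fin d) (y : EuclideanSpace ℝ (Fin d)) : ℝ :=
  μ (pt x₀ y) (coordVec x₀ y i)

/-- The Christoffel symbols `Γ^k_ij` of the Levi-Civita connection. -/
def christoffel (k i j : Fin d) (y : EuclideanSpace ℝ (Fin d)) : ℝ :=
  (1 / 2) * ∑ l, invMetricCoord g x₀ y k l *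
    (pderiv i (fun z ↦ metricCoord g x₀ z j l) y + pderiv j (fun z ↦ metricCoord g x₀ z i l) y
      - pderiv l (fun z ↦ metricCoord g x₀ z i j) y)

/-- The components `R_ij^k_l` of the curvature, `(∇_i ∇_j - ∇_j ∇_i) V^k = R_ij^k_l V^l`. -/
def riemann (i j k l : Fin d) (y : EuclideanSpace ℝ (Fin d)) : ℝ :=
  pderiv i (christoffel g x₀ k j l) y - pderiv j (christoffel g x₀ k i l) y
    + ∑ m, (christoffel g x₀ k i m y * christoffel g x₀ m j l y
      - christoffel g x₀ k j m y * christoffel g x₀ m i l y)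

/-- The Ricci tensor `Ric_ij = R_ki^k_j`. -/
def ricci (i j : Fin d) (y : EuclideanSpace ℝ (Fin d)) : ℝ := ∑ k, riemann g x₀ k i k j y

/-- The scalar curvature. -/
def scalarCurvature (y : EuclideanSpace ℝ (Fin d)) : ℝ :=
  ∑ i, ∑ j, invMetricCoord g x₀ y i j * ricci g x₀ i j y

/-- The trace `J` of the Schouten tensor. -/
def schoutenTrace (y : EuclideanSpace ℝ (Fin d)) : ℝ :=
  scalarCurvature g x₀ y / (2 * ((d : ℝ) - 1))

/-- The Schouten tensor `P_ij`, determined by `Ric = (d - 2) P + J g` with `J = tr P`. -/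
def schouten (i j : Fin d) (y : EuclideanSpace ℝ (Fin d)) : ℝ :=
  (ricci g x₀ i j y - schoutenTrace g x₀ y * metricCoord g x₀ y i j) / ((d : ℝ) - 2)

/-- The covariant derivative `∇_i μ_j` of a covector field. -/
def covDeriv (μ : CovectorField d M) (i j : Fin d) (y : EuclideanSpace ℝ (Fin d)) : ℝ :=
  pderiv i (covectorCoord x₀ μ j) y - ∑ k, christoffel g x₀ k i j y * covectorCoord x₀ μ k y

/-- The positive energy Laplacian `Δ s = - g^ij ∇_i ∇_j s`. -/
def laplacian (s : M → ℝ) (y : EuclideanSpace ℝ (Fin d)) : ℝ :=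
  - ∑ i, ∑ j, invMetricCoord g x₀ y i j * covDeriv g x₀ (differential s) i j y

/-- `S(g, s) = (2 / d) s (J - Δ) s - |ds|²`. -/
def almostScalar (s : M → ℝ) (y : EuclideanSpace ℝ (Fin d)) : ℝ :=
  (2 / (d : ℝ)) * s (pt x₀ y) * (schoutenTrace g x₀ y * s (pt x₀ y) - laplacian g x₀ s y)
    - cometric (g (pt x₀ y)) (differential s (pt x₀ y)) (differential s (pt x₀ y))

end Coordinates

section Tractors

variable {d : ℕ} [NeZero d]
  {M : Type*} [TopologicalSpace M] [ChartedSpace (EuclideanHalfSpace d) M]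

/-- The metric `e^{2u} g`. -/
def rescale (u : M → ℝ) (g : BilinField d M) : BilinField d M :=
  fun x ↦ Real.exp (2 * u x) • g x

variable (d M) in
/-- A conformal structure: a class of smooth Riemannian metrics on `M` modulo `g ∼ e^{2u} g`
with `u` smooth. -/
structure ConformalStructure [IsManifold (𝓡∂ d) ∞ M] where
  metrics : Set (BilinField d M)
  nonempty : metrics.Nonempty
  isMetric : ∀ g ∈ metrics, IsRiemannianMetricOn g univ
  rescale_mem : ∀ g ∈ metrics, ∀ u : M → ℝ, ContMDiff (𝓡∂ d) 𝓘(ℝ, ℝ) ∞ u →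
    rescale u g ∈ metrics
  conformal : ∀ g ∈ metrics, ∀ g' ∈ metrics,
    ∃ u : M → ℝ, ContMDiff (𝓡∂ d) 𝓘(ℝ, ℝ) ∞ u ∧ g' = rescale u g

/-- The triple `(σ, μ, ρ)` in `ℝ ⊕ T*ₓM ⊕ ℝ` which represents an element of the standard tractor
bundle at `x` in the splitting `E[1] ⊕ T*M[1] ⊕ E[-1]` given by a metric of the conformal class
(which also trivialises the density bundles). -/
@[ext] structure SplitTractor (d : ℕ) [NeZero d] {M : Type*} [TopologicalSpace M]
    [ChartedSpace (EuclideanHalfSpace d) M] (x : M) where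
  σ : ℝ
  μ : TangentSpace (𝓡∂ d) x →L[ℝ] ℝ
  ρ : ℝ

/-- The tractor metric in a splitting: the polarisation of `(σ, μ, ρ) ↦ g⁻¹(μ, μ) + 2 σ ρ`. -/
def tractorMetric {x : M} (B : TangentSpace (𝓡∂ d) x →L[ℝ] TangentSpace (𝓡∂ d) x →L[ℝ] ℝ)
    (s t : SplitTractor d x) : ℝ :=
  cometric B s.μ t.μ + s.σ * t.ρ + s.ρ * t.σ

/-- The change of splitting for `g ↦ e^{2u} g`. With `Υ = du`, the transformation of densities is
`(σ, μ, ρ) ↦ (σ, μ + σ Υ, ρ - g⁻¹(Υ, μ) - σ g⁻¹(Υ, Υ) / 2)`; the powers of `e^u` come from the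
trivialisations of the bundles of weights `1`, `1` and `-1` by the two metrics. -/
def changeSplitting (g : BilinField d M) (u : M → ℝ) {x : M} (t : SplitTractor d x) :
    SplitTractor d x where
  σ := Real.exp (u x) * t.σ
  μ := Real.exp (u x) • (t.μ + t.σ • differential u x)
  ρ := Real.exp (-u x) * (t.ρ - cometric (g x) (differential u x) t.μ
    - (1 / 2) * t.σ * cometric (g x) (differential u x) (differential u x))

/-- A smooth section of the standard tractor bundle of the conformal structure `c`, given by its
representations in the splittings of all metrics of the class. -/
structure Tractor [IsManifold (𝓡∂ d) ∞ M] (c : ConformalStructure d M) where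
  val : ∀ (_ : c.metrics) (x : M), SplitTractor d x
  val_rescale : ∀ (g g' : c.metrics) (u : M → ℝ), ContMDiff (𝓡∂ d) 𝓘(ℝ, ℝ) ∞ u →
    (g' : BilinField d M) = rescale u g →
    ∀ x, val g' x = changeSplitting (g : BilinField d M) u (val g x)
  smooth_σ : ∀ g, ContMDiff (𝓡∂ d) 𝓘(ℝ, ℝ) ∞ fun x ↦ (val g x).σ
  smooth_μ : ∀ g, ContMDiff (𝓡∂ d) ((𝓡∂ d).prod 𝓘(ℝ, EuclideanSpace ℝ (Fin d) →L[ℝ] ℝ)) ∞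
    fun x ↦ TotalSpace.mk' (EuclideanSpace ℝ (Fin d) →L[ℝ] ℝ)
      (E := fun x : M ↦ TangentSpace (𝓡∂ d) x →L[ℝ] Bundle.Trivial M ℝ x) x (val g x).μ
  smooth_ρ : ∀ g, ContMDiff (𝓡∂ d) 𝓘(ℝ, ℝ) ∞ fun x ↦ (val g x).ρ

/-- The components, in the splitting of `g` and in the chart at `x₀`, of the derivative in the
direction `∂ᵢ` by the normal tractor connection of a field of tractors
`t = (σ, μ, ρ)`: `(∇_i σ - μ_i, ∇_i μ_j + g_ij ρ + P_ij σ, ∇_i ρ - P_ij μ^j)`. -/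
def tractorConnection (g : BilinField d M) (t : ∀ x : M, SplitTractor d x) (x₀ : M)
    (y : EuclideanSpace ℝ (Fin d)) (i : Fin d) : ℝ × (Fin d → ℝ) × ℝ :=
  (pderiv i (fun z ↦ (t (pt x₀ z)).σ) y - covectorCoord x₀ (fun x ↦ (t x).μ) i y,
    fun j ↦ covDeriv g x₀ (fun x ↦ (t x).μ) i j y + metricCoord g x₀ y i j * (t (pt x₀ y)).ρ
      + schouten g x₀ i j y * (t (pt x₀ y)).σ,
    pderiv i (fun z ↦ (t (pt x₀ z)).ρ) y
      - ∑ j, ∑ k, schouten g x₀ i j y * invMetricCoord g x₀ y j k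
        * covectorCoord x₀ (fun x ↦ (t x).μ) k y)

/-- The canonical tractor `X` (of weight one), which is `(0, 0, 1)` in every splitting. -/
def canonicalX (x : M) : SplitTractor d x := ⟨0, 0, 1⟩

namespace Tractor

variable [IsManifold (𝓡∂ d) ∞ M] {c : ConformalStructure d M} (T : Tractor c)

/-- `T` is parallel for the tractor connection. -/
def IsParallel : Prop :=
  ∀ (g : c.metrics) (x₀ : M), ∀ y ∈ (extChartAt (𝓡∂ d) x₀).target, ∀ i,
    tractorConnection (g : BilinField d M) (T.val g) x₀ y i = 0

/-- `(M, c, T)` is a (directed) almost Einstein structure: `T` is parallel and `T ≠ 0`. -/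
def IsAlmostEinstein : Prop :=
  T.IsParallel ∧ ∃ (g : c.metrics) (x : M), T.val g x ≠ ⟨0, 0, 0⟩

/-- `|T|² = h(T, T)`, computed in the splitting of `g`. -/
def normSq (g : c.metrics) (x : M) : ℝ :=
  tractorMetric ((g : BilinField d M) x) (T.val g x) (T.val g x)

/-- The density `σ = h(X, T)` of weight one, as a function in the trivialisation given by `g`. -/
def scale (g : c.metrics) (x : M) : ℝ :=
  tractorMetric ((g : BilinField d M) x) (canonicalX x) (T.val g x)

/-- The scale singularity set, the zero set of `σ`. -/
def singularSet : Set M := {x | ∀ g : c.metrics, T.scale g x = 0}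

/-- The metric `σ⁻² 𝐠` off the scale singularity set, computed from the metric `g` of the class. -/
def scaleMetric (g : c.metrics) : BilinField d M :=
  fun x ↦ ((T.scale g x) ^ 2)⁻¹ • (g : BilinField d M) x

/-- The structure is scalar negative: `S(g, σ) < 0` everywhere. -/
def IsScalarNegative : Prop :=
  ∀ (g : c.metrics) (x₀ : M), ∀ y ∈ (extChartAt (𝓡∂ d) x₀).target,
    almostScalar (g : BilinField d M) x₀ (T.scale g) y < 0

end Tractor

end Tractors

section PoincareEinstein

variable {d : ℕ} [NeZero d]
  {M : Type*} [TopologicalSpace M] [ChartedSpace (EuclideanHalfSpace d) M]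

variable (d) in
/-- `s` is a non-negative smooth defining function for the boundary of `M`. -/
structure IsDefiningFunction (s : M → ℝ) : Prop where
  smooth : ContMDiff (𝓡∂ d) 𝓘(ℝ, ℝ) ∞ s
  nonneg : ∀ x, 0 ≤ s x
  zero_iff : ∀ x, s x = 0 ↔ x ∈ (𝓡∂ d).boundary M
  differential_ne_zero : ∀ x ∈ (𝓡∂ d).boundary M, differential (d := d) s x ≠ 0

/-- The smooth metric `g` on `M` is the conformal compactification of the metric `g₀` on the
interior of `M` by the defining function `s`, i.e. `g` extends `s² g₀` to `M`. -/
structure IsConformalCompactification [IsManifold (𝓡∂ d) ∞ M]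
    (g₀ : BilinField d M) (s : M → ℝ) (g : BilinField d M) : Prop where
  interior_metric : IsRiemannianMetricOn g₀ ((𝓡∂ d).interior M)
  defining : IsDefiningFunction d s
  metric : IsRiemannianMetricOn g univ
  extends_metric : ∀ x ∈ (𝓡∂ d).interior M, g x = (s x) ^ 2 • g₀ x

/-- The metric `g₀` on the interior of `M` satisfies `Ric(g₀) = -(d - 1) g₀`. -/
def IsNormalisedEinstein (g₀ : BilinField d M) : Prop :=
  ∀ x₀ : M, ∀ y ∈ (extChartAt (𝓡∂ d) x₀).target, pt x₀ y ∈ (𝓡∂ d).interior M →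
    ∀ i j, ricci g₀ x₀ i j y = -((d : ℝ) - 1) * metricCoord g₀ x₀ y i j

/-- `(M, g₀)`, with `g₀` a metric on the interior of `M`, is Poincaré-Einstein: `g₀` is conformally
compact and Einstein with `Ric(g₀) = -(d - 1) g₀`. -/
def IsPoincareEinstein [IsManifold (𝓡∂ d) ∞ M] (g₀ : BilinField d M) : Prop :=
  (∃ s g, IsConformalCompactification g₀ s g) ∧ IsNormalisedEinstein g₀

end PoincareEinstein

section ConformalClass

variable {d : ℕ} [NeZero d]
  {M : Type*} [TopologicalSpace M] [ChartedSpace (EuclideanHalfSpace d) M]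
  [IsManifold (𝓡∂ d) ∞ M]

/-- `e^{2u} g` is a smooth Riemannian metric. -/
theorem IsRiemannianMetricOn.rescale {g : BilinField d M} (hg : IsRiemannianMetricOn g univ)
    {u : M → ℝ} (hu : ContMDiff (𝓡∂ d) 𝓘(ℝ, ℝ) ∞ u) :
    IsRiemannianMetricOn (AlmostEinstein.rescale u g) univ where
  symm x hx v w := by
    simp [AlmostEinstein.rescale, hg.symm x hx v w]
  pos x hx v hv := by
    exact mul_pos (Real.exp_pos _) (hg.pos x hx v hv)
  smooth := by
    have h : ContMDiff (𝓡∂ d) 𝓘(ℝ, ℝ) ∞ fun x ↦ Real.exp (2 * u x) :=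
      (Real.contDiff_exp.comp (contDiff_const.mul contDiff_id)).contMDiff.comp hu
    exact h.contMDiffOn.smul_section hg.smooth

/-- The conformal structure `[g]` of a metric `g`. -/
def ConformalStructure.ofMetric (g : BilinField d M) (hg : IsRiemannianMetricOn g univ) :
    ConformalStructure d M where
  metrics := {g' | ∃ u : M → ℝ, ContMDiff (𝓡∂ d) 𝓘(ℝ, ℝ) ∞ u ∧ g' = rescale u g}
  nonempty := ⟨_, 0, contMDiff_const, rfl⟩
  isMetric := by
    rintro _ ⟨u, hu, rfl⟩
    exact hg.rescale hu
  rescale_mem := by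
    rintro _ ⟨u, hu, rfl⟩ v hv
    refine ⟨v + u, hv.add hu, ?_⟩
    funext x
    simp [rescale, smul_smul, ← Real.exp_add, mul_add]
  conformal := by
    rintro _ ⟨u, hu, rfl⟩ _ ⟨v, hv, rfl⟩
    refine ⟨v - u, hv.sub hu, ?_⟩
    funext x
    simp [rescale, smul_smul, ← Real.exp_add, mul_sub]

end ConformalClass

end AlmostEinstein

end

open AlmostEinstein

/-! Fix a metric `g` of the class and let `s` be the scale of `I` in its splitting. The top slot of
`∇I = 0` says `μ = ds`, and the middle slot is the almost Einstein equation `∇∇s + ρ g + s P = 0`,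
whose trace determines `ρ = -(J s + tr ∇∇s) / d`. Everything rests on the conformal change of the
Ricci tensor, for `g' = s⁻² g` (`ricci_conformal`): `Ric' = Ric + (d - 2) ∇∇s / s + (tr ∇∇s / s - (d
- 1) |ds|² / s²) g`.

From tractor to metric: substituting the almost Einstein equation and its trace cancels all
curvature of `g` and leaves `Ric' = -(d - 1) (|ds|² + 2 s ρ) g'`. The bracket is `|I|² = 1`. On the
boundary `s = 0`, so `|ds|² = 1` and `ds ≠ 0` there. Finally `|s|` is smooth, because a function
vanishing only on the boundary keeps its sign on small half balls.

From metric to tractor: define `ρ` by the trace formula. The trace of the Einstein equation is `|I|²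
= 1` (`gradSq_of_einstein`); inserting this back gives the almost Einstein equation after division
by `s` and by `d - 2` (`almostEinstein_of_einstein`). Differentiating `|I|² = 1` and dividing by `s`
yields the bottom slot (`pderiv_rho`). These divisions are legitimate only where `s ≠ 0`, but that
set is dense because `ds ≠ 0` on the boundary, and all quantities are continuous up to the boundary
(`eq_of_forall_ne_zero`).

The same density argument replaces the transformation law of the Schouten tensor. Where `s ≠ 0` the
length condition forces `ρ = (1 - |ds|²) / (2 s)`, which is visibly independent of the chart
(`rho_eq`) and transforms correctly under a change of metric (`scaleTractor_rescale`). Scalar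
negativity is `S(σ) = -|I|² = -1`. -/

namespace AlmostEinstein

/-! ### Calculus of one-sided partial derivatives on the half space. -/

section PartialDerivatives

variable {d : ℕ} [NeZero d]

/-- Smoothness at `y` of a function on the half space, up to the boundary. -/
abbrev SmoothAt (f : EuclideanSpace ℝ (Fin d) → ℝ) (y : EuclideanSpace ℝ (Fin d)) : Prop :=
  ContDiffWithinAt ℝ ∞ f (range (𝓡∂ d)) y

variable {f g : EuclideanSpace ℝ (Fin d) → ℝ} {y : EuclideanSpace ℝ (Fin d)}

theorem uniqueDiffWithinAt_halfSpace (hy : y ∈ range (𝓡∂ d)) :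
    UniqueDiffWithinAt ℝ (range (𝓡∂ d)) y :=
  (𝓡∂ d).uniqueDiffOn y hy

theorem SmoothAt.differentiable (hf : SmoothAt f y) :
    DifferentiableWithinAt ℝ f (range (𝓡∂ d)) y :=
  ContDiffWithinAt.differentiableWithinAt hf (by simp)

theorem SmoothAt.pderiv (hf : SmoothAt f y) (hy : y ∈ range (𝓡∂ d)) (i : Fin d) :
    SmoothAt (pderiv i f) y := by
  have h : ContDiffWithinAt ℝ ∞ (fderivWithin ℝ f (range (𝓡∂ d))) (range (𝓡∂ d)) y :=
    ContDiffWithinAt.fderivWithin_right hf (𝓡∂ d).uniqueDiffOn (by simp) hy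
  exact h.clm_apply contDiffWithinAt_const

theorem SmoothAt.matrix_det {ι : Type*} [Fintype ι] [DecidableEq ι]
    {A : EuclideanSpace ℝ (Fin d) → Matrix ι ι ℝ}
    (hA : ∀ i j, SmoothAt (fun z ↦ A z i j) y) : SmoothAt (fun z ↦ (A z).det) y := by
  simp only [Matrix.det_apply]
  refine ContDiffWithinAt.sum fun σ _ ↦ ?_
  exact (contDiffWithinAt_prod fun i _ ↦ hA _ _).const_smul _

/-- Cramer's rule: the entries are determinants of smooth matrices divided by a nonvanishing
determinant. -/
theorem SmoothAt.matrix_inv {ι : Type*} [Fintype ι] [DecidableEq ι]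
    {A : EuclideanSpace ℝ (Fin d) → Matrix ι ι ℝ}
    (hA : ∀ i j, SmoothAt (fun z ↦ A z i j) y) (hdet : (A y).det ≠ 0) (i j : ι) :
    SmoothAt (fun z ↦ (A z)⁻¹ i j) y := by
  simp only [Matrix.inv_def, Matrix.smul_apply, smul_eq_mul, Ring.inverse_eq_inv',
    Matrix.adjugate_apply]
  refine ((SmoothAt.matrix_det hA).inv hdet).mul (SmoothAt.matrix_det fun k l ↦ ?_)
  simp only [Matrix.updateRow_apply]
  split_ifs
  · exact contDiffWithinAt_const
  · exact hA _ _

theorem pderiv_congr (hy : y ∈ range (𝓡∂ d)) (h : f =ᶠ[𝓝[range (𝓡∂ d)] y] g) (i : Fin d) :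
    pderiv i f y = pderiv i g y := by
  simp only [pderiv]
  rw [h.fderivWithin_eq (h.eq_of_nhdsWithin hy)]

theorem pderiv_add (hy : y ∈ range (𝓡∂ d)) (hf : SmoothAt f y) (hg : SmoothAt g y) (i : Fin d) :
    pderiv i (fun z ↦ f z + g z) y = pderiv i f y + pderiv i g y := by
  simp only [pderiv]
  rw [fderivWithin_fun_add (uniqueDiffWithinAt_halfSpace hy) hf.differentiable hg.differentiable]
  rfl

theorem pderiv_sub (hy : y ∈ range (𝓡∂ d)) (hf : SmoothAt f y) (hg : SmoothAt g y) (i : Fin d) :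
    pderiv i (fun z ↦ f z - g z) y = pderiv i f y - pderiv i g y := by
  simp only [pderiv]
  rw [fderivWithin_fun_sub (uniqueDiffWithinAt_halfSpace hy) hf.differentiable hg.differentiable]
  rfl

theorem pderiv_neg (hy : y ∈ range (𝓡∂ d)) (i : Fin d) :
    pderiv i (fun z ↦ -f z) y = -pderiv i f y := by
  simp only [pderiv]
  rw [fderivWithin_fun_neg (uniqueDiffWithinAt_halfSpace hy)]
  rfl

theorem pderiv_mul (hy : y ∈ range (𝓡∂ d)) (hf : SmoothAt f y) (hg : SmoothAt g y) (i : Fin d) :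
    pderiv i (fun z ↦ f z * g z) y = pderiv i f y * g y + f y * pderiv i g y := by
  simp only [pderiv]
  rw [fderivWithin_fun_mul (uniqueDiffWithinAt_halfSpace hy) hf.differentiable hg.differentiable]
  simp
  ring

theorem pderiv_const (c : ℝ) (i : Fin d) : pderiv i (fun _ ↦ c) y = 0 := by
  simp [pderiv]

theorem pderiv_const_mul (hy : y ∈ range (𝓡∂ d)) (hf : SmoothAt f y) (c : ℝ) (i : Fin d) :
    pderiv i (fun z ↦ c * f z) y = c * pderiv i f y := by
  rw [pderiv_mul hy contDiffWithinAt_const hf, pderiv_const]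
  ring

theorem pderiv_sum {ι : Type*} (s : Finset ι) {F : ι → EuclideanSpace ℝ (Fin d) → ℝ}
    (hy : y ∈ range (𝓡∂ d)) (hF : ∀ k ∈ s, SmoothAt (F k) y) (i : Fin d) :
    pderiv i (fun z ↦ ∑ k ∈ s, F k z) y = ∑ k ∈ s, pderiv i (F k) y := by
  simp only [pderiv]
  rw [fderivWithin_fun_sum (uniqueDiffWithinAt_halfSpace hy) fun k hk ↦ (hF k hk).differentiable]
  simp

theorem pderiv_inv (hy : y ∈ range (𝓡∂ d)) (hf : SmoothAt f y) (h0 : f y ≠ 0) (i : Fin d) :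
    pderiv i (fun z ↦ (f z)⁻¹) y = -pderiv i f y / f y ^ 2 := by
  have h := ((hasDerivAt_inv h0).comp_hasFDerivWithinAt y
    hf.differentiable.hasFDerivWithinAt).fderivWithin (uniqueDiffWithinAt_halfSpace hy)
  simp only [pderiv]
  have e : (fun z ↦ (f z)⁻¹) = Inv.inv ∘ f := rfl
  rw [e, h]
  simp
  field_simp

theorem pderiv_comm (hy : y ∈ range (𝓡∂ d)) (hf : SmoothAt f y) (i j : Fin d) :
    pderiv i (pderiv j f) y = pderiv j (pderiv i f) y := by
  have hd : DifferentiableWithinAt ℝ (fderivWithin ℝ f (range (𝓡∂ d))) (range (𝓡∂ d)) y :=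
    (ContDiffWithinAt.fderivWithin_right (m := ∞) hf (𝓡∂ d).uniqueDiffOn (by simp)
      hy).differentiableWithinAt (by simp)
  have key : ∀ i j : Fin d, pderiv i (pderiv j f) y =
      fderivWithin ℝ (fderivWithin ℝ f (range (𝓡∂ d))) (range (𝓡∂ d)) y
        (EuclideanSpace.single i 1) (EuclideanSpace.single j 1) := by
    intro i j
    change fderivWithin ℝ (fun z ↦ fderivWithin ℝ f (range (𝓡∂ d)) z
      (EuclideanSpace.single j 1)) _ y _ = _
    rw [fderivWithin_clm_apply (uniqueDiffWithinAt_halfSpace hy) hd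
      (differentiableWithinAt_const _)]
    simp
  -- Second derivatives stay symmetric at boundary points because the half space lies in the closure
  -- of its interior.
  have hsymm : IsSymmSndFDerivWithinAt ℝ f (range (𝓡∂ d)) y :=
    ContDiffWithinAt.isSymmSndFDerivWithinAt hf
      (by rw [minSmoothness_of_isRCLikeNormedField]; exact WithTop.coe_le_coe.2 le_top) (𝓡∂ d).uniqueDiffOn
      ((𝓡∂ d).range_subset_closure_interior hy) hy
  rw [key, key, hsymm]

end PartialDerivatives

/-! ### Pointwise algebra of the conformal change of curvature. -/

section Algebra

variable {ι : Type*} [Fintype ι] [DecidableEq ι]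

/-- The change of the Christoffel symbols under a conformal change of the metric `G`: here `v` is
the vector dual to the logarithmic derivative `a` of the conformal factor. -/
def conformalDifference (G : ι → ι → ℝ) (a v : ι → ℝ) (k i j : ι) : ℝ :=
  (if k = j then a i else 0) + (if k = i then a j else 0) - G i j * v k

/-- The first and last terms cancel in the contraction. What remains is the logarithmic derivative
of the change in the volume density. -/
theorem sum_conformalDifference_contract {G : ι → ι → ℝ} {a v : ι → ℝ}
    (hG : ∀ i j, G i j = G j i) (hv : ∀ i, ∑ k, G i k * v k = a i) (j : ι) :
    ∑ k, conformalDifference G a v k k j = Fintype.card ι * a j := by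
  have h : ∑ k, G k j * v k = a j := by
    rw [← hv]; exact Finset.sum_congr rfl fun k _ ↦ by rw [hG]
  simp [conformalDifference, Finset.sum_add_distrib, Finset.sum_sub_distrib, h]

theorem sum_mul_conformalDifference (G : ι → ι → ℝ) (a v b : ι → ℝ) (i j : ι) :
    ∑ k, b k * conformalDifference G a v k i j
      = b j * a i + b i * a j - G i j * ∑ k, b k * v k := by
  simp only [conformalDifference, mul_add, mul_sub, Finset.sum_add_distrib,
    Finset.sum_sub_distrib, mul_ite, mul_zero, Finset.sum_ite_eq', Finset.mem_univ, if_true,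
    Finset.mul_sum]
  congr 1
  exact Finset.sum_congr rfl fun k _ ↦ by ring

theorem sum_conformalDifference_mul (G : ι → ι → ℝ) (a v b : ι → ℝ) (k i : ι) :
    ∑ m, conformalDifference G a v k i m * b m
      = a i * b k + (if k = i then ∑ m, a m * b m else 0) - v k * ∑ m, G i m * b m := by
  simp only [conformalDifference, add_mul, sub_mul, Finset.sum_add_distrib,
    Finset.sum_sub_distrib, ite_mul, zero_mul, Finset.sum_ite_eq, Finset.mem_univ, if_true,
    Finset.mul_sum]
  congr 1
  · congr 1
    split_ifs <;> simp
  · exact Finset.sum_congr rfl fun k _ ↦ by ring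

/-- The change of the Ricci curvature under a conformal change of the metric, as an algebraic
identity between the values and the first derivatives at a point. -/
theorem ricci_conformal_algebra {G : ι → ι → ℝ} {Γ DG : ι → ι → ι → ℝ} {a v : ι → ℝ}
    {Da Dv : ι → ι → ℝ} (hG : ∀ i j, G i j = G j i) (hΓ : ∀ k i j, Γ k i j = Γ k j i)
    (hDa : ∀ i j, Da i j = Da j i) (hv : ∀ i, ∑ k, G i k * v k = a i)
    (hDv : ∀ l i, ∑ k, (DG l i k * v k + G i k * Dv l k) = Da l i)
    (hDG : ∀ m i j, DG m i j = ∑ k, (Γ k m i * G k j + Γ k m j * G k i)) (i j : ι) :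
    ∑ k, (((if k = j then Da k i else 0) + (if k = i then Da k j else 0)
          - (DG k i j * v k + G i j * Dv k k))
        - ((if k = j then Da i k else 0) + Da i j - (DG i k j * v k + G k j * Dv i k))
        + ∑ m, ((Γ k k m + conformalDifference G a v k k m)
              * (Γ m i j + conformalDifference G a v m i j)
            - (Γ k i m + conformalDifference G a v k i m)
              * (Γ m k j + conformalDifference G a v m k j)))
      = ∑ k, ∑ m, (Γ k k m * Γ m i j - Γ k i m * Γ m k j)
        - (Fintype.card ι - 2) * (Da i j - ∑ m, Γ m i j * a m - a i * a j
          + G i j * ∑ m, a m * v m)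
        - G i j * (∑ k, Dv k k + ∑ k, ∑ m, Γ k k m * v m) := by
  -- The product of the shifted symbols expands into six contractions, `ha` to `hf`. The traces `Γ k
  -- k j` cancel among them, and the terms `Γ G v` cancel against `DG v` by metric compatibility,
  -- which is `hg`.
  set C := conformalDifference G a v with hC
  have hv' : ∀ j, ∑ k, G k j * v k = a j := fun j ↦ by
    rw [← hv]; exact Finset.sum_congr rfl fun k _ ↦ by rw [hG]
  have h1 : ∑ k, ((if k = j then Da k i else 0) + (if k = i then Da k j else 0)
      - (DG k i j * v k + G i j * Dv k k))
      = 2 * Da i j - ∑ k, DG k i j * v k - G i j * ∑ k, Dv k k := by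
    simp only [Finset.sum_add_distrib, Finset.sum_sub_distrib, Finset.sum_ite_eq',
      Finset.mem_univ, if_true, ← Finset.mul_sum, hDa j i]
    ring
  have h2 : ∑ k, ((if k = j then Da i k else 0) + Da i j - (DG i k j * v k + G k j * Dv i k))
      = Fintype.card ι * Da i j := by
    have : ∑ k, (DG i k j * v k + G k j * Dv i k) = Da i j := by
      rw [← hDv]
      refine Finset.sum_congr rfl fun k _ ↦ ?_
      rw [hG k j, hDG i k j, hDG i j k]
      congr 2
      exact Finset.sum_congr rfl fun k _ ↦ by ring
    rw [Finset.sum_sub_distrib, this]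
    simp [Finset.sum_add_distrib]
  have ha : ∑ k, ∑ m, Γ k k m * C m i j
      = (∑ k, Γ k k j) * a i + (∑ k, Γ k k i) * a j - G i j * ∑ k, ∑ m, Γ k k m * v m := by
    simp only [hC, sum_mul_conformalDifference, Finset.sum_add_distrib, Finset.sum_sub_distrib,
      Finset.sum_mul, Finset.mul_sum]
  have hb : ∑ k, ∑ m, C k k m * Γ m i j = Fintype.card ι * ∑ m, Γ m i j * a m := by
    rw [Finset.sum_comm]
    simp only [← Finset.sum_mul, hC, sum_conformalDifference_contract hG hv, Finset.mul_sum]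
    exact Finset.sum_congr rfl fun k _ ↦ by ring
  have hc : ∑ k, ∑ m, C k k m * C m i j
      = Fintype.card ι * (2 * (a i * a j) - G i j * ∑ m, a m * v m) := by
    rw [Finset.sum_comm]
    simp only [← Finset.sum_mul, hC, sum_conformalDifference_contract hG hv, mul_assoc,
      ← Finset.mul_sum, sum_mul_conformalDifference]
    ring
  have hd : ∑ k, ∑ m, Γ k i m * C m k j
      = ∑ k, Γ k i j * a k + (∑ k, Γ k k i) * a j - ∑ k, ∑ m, Γ k m i * G k j * v m := by
    simp only [hC, sum_mul_conformalDifference, Finset.sum_add_distrib, Finset.sum_sub_distrib,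
      Finset.sum_mul, Finset.mul_sum]
    congr 2
    · exact Finset.sum_congr rfl fun k _ ↦ by rw [hΓ]
    · ext k
      exact Finset.sum_congr rfl fun m _ ↦ by rw [hΓ k i m]; ring
  have he : ∑ k, ∑ m, C k i m * Γ m k j
      = (∑ k, Γ k k j) * a i + ∑ m, Γ m i j * a m - ∑ k, ∑ m, Γ k m j * G k i * v m := by
    simp only [hC, sum_conformalDifference_mul, Finset.sum_add_distrib, Finset.sum_sub_distrib,
      Finset.sum_mul, Finset.mul_sum, Finset.sum_ite_eq', Finset.mem_univ, if_true]
    congr 1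
    · congr 1
      · exact Finset.sum_congr rfl fun k _ ↦ by ring
      · exact Finset.sum_congr rfl fun k _ ↦ by ring
    · rw [Finset.sum_comm]
      exact Finset.sum_congr rfl fun k _ ↦ Finset.sum_congr rfl fun m _ ↦ by rw [hG k i]; ring
  have hf : ∑ k, ∑ m, C k i m * C m k j
      = (Fintype.card ι + 2) * (a i * a j) - 2 * (G i j * ∑ m, a m * v m) := by
    have e : ∀ k, ∑ m, C k i m * C m k j = a i * C k k j
        + (if k = i then ∑ m, a m * C m k j else 0) - v k * ∑ m, G i m * C m k j :=
      fun k ↦ by rw [hC, sum_conformalDifference_mul]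
    have e2 : ∀ k, ∑ m, G i m * C m k j = G i j * a k + G i k * a j - G k j * a i := fun k ↦ by
      rw [hC, sum_mul_conformalDifference, hv]
    simp only [e, e2, Finset.sum_add_distrib, Finset.sum_sub_distrib, ← Finset.mul_sum,
      Finset.sum_ite_eq', Finset.mem_univ, if_true]
    have e3 : ∑ k, v k * (G i j * a k + G i k * a j - G k j * a i)
        = G i j * ∑ m, a m * v m := by
      have : ∀ k, v k * (G i j * a k + G i k * a j - G k j * a i)
        = G i j * (a k * v k) + (G i k * v k) * a j - (G k j * v k) * a i := fun k ↦ by ring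
      simp only [this, Finset.sum_add_distrib, Finset.sum_sub_distrib, ← Finset.mul_sum,
        ← Finset.sum_mul, hv, hv']
      ring
    rw [e3, hC, sum_conformalDifference_contract hG hv, sum_mul_conformalDifference]
    ring
  have hg : ∑ m, DG m i j * v m
      = ∑ k, ∑ m, Γ k m i * G k j * v m + ∑ k, ∑ m, Γ k m j * G k i * v m := by
    simp only [hDG, Finset.sum_mul, add_mul, Finset.sum_add_distrib]
    rw [Finset.sum_comm]
    congr 1
    rw [Finset.sum_comm]
  have hS : ∑ k, ∑ m, ((Γ k k m + C k k m) * (Γ m i j + C m i j)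
        - (Γ k i m + C k i m) * (Γ m k j + C m k j))
      = ∑ k, ∑ m, (Γ k k m * Γ m i j - Γ k i m * Γ m k j)
        + (∑ k, ∑ m, Γ k k m * C m i j + ∑ k, ∑ m, C k k m * Γ m i j
          + ∑ k, ∑ m, C k k m * C m i j
          - ∑ k, ∑ m, Γ k i m * C m k j - ∑ k, ∑ m, C k i m * Γ m k j
          - ∑ k, ∑ m, C k i m * C m k j) := by
    simp only [← Finset.sum_add_distrib, ← Finset.sum_sub_distrib]
    exact Finset.sum_congr rfl fun k _ ↦ Finset.sum_congr rfl fun m _ ↦ by ring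
  rw [Finset.sum_add_distrib, Finset.sum_sub_distrib, h1, h2, hS, ha, hb, hc, hd, he, hf, hg]
  ring

end Algebra

/-! ### Levi-Civita calculus in a chart. -/

section CoordinateGeometry

variable {d : ℕ} [NeZero d]
  {M : Type*} [TopologicalSpace M] [ChartedSpace (EuclideanHalfSpace d) M]

/-- The components of `g` in the chart at `x₀` form a smooth nondegenerate symmetric matrix on the
relatively open subset `U` of the half space. -/
structure IsCoordMetricOn (g : BilinField d M) (x₀ : M) (U : Set (EuclideanSpace ℝ (Fin d))) :
    Prop where
  subset : U ⊆ range (𝓡∂ d)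
  mem_nhds : ∀ y ∈ U, U ∈ 𝓝[range (𝓡∂ d)] y
  smooth : ∀ y ∈ U, ∀ i j, SmoothAt (fun z ↦ metricCoord g x₀ z i j) y
  symm : ∀ y ∈ U, ∀ i j, metricCoord g x₀ y i j = metricCoord g x₀ y j i
  det_ne : ∀ y ∈ U, (metricCoord g x₀ y).det ≠ 0

/-- The coordinate Hessian `∇_i ∇_j f` of a function of the coordinates. -/
noncomputable def hessian (g : BilinField d M) (x₀ : M) (f : EuclideanSpace ℝ (Fin d) → ℝ) (i j : Fin d)
    (y : EuclideanSpace ℝ (Fin d)) : ℝ :=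
  pderiv i (pderiv j f) y - ∑ k, christoffel g x₀ k i j y * pderiv k f y

/-- The trace `g^ij ∇_i ∇_j f`. -/
noncomputable def traceHessian (g : BilinField d M) (x₀ : M) (f : EuclideanSpace ℝ (Fin d) → ℝ)
    (y : EuclideanSpace ℝ (Fin d)) : ℝ :=
  ∑ i, ∑ j, invMetricCoord g x₀ y i j * hessian g x₀ f i j y

/-- The squared length `g^ij ∂_i f ∂_j f` of the gradient. -/
noncomputable def gradSq (g : BilinField d M) (x₀ : M) (f : EuclideanSpace ℝ (Fin d) → ℝ)
    (y : EuclideanSpace ℝ (Fin d)) : ℝ :=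
  ∑ i, ∑ j, invMetricCoord g x₀ y i j * pderiv i f y * pderiv j f y

namespace IsCoordMetricOn

variable {g g' : BilinField d M} {x₀ : M} {U : Set (EuclideanSpace ℝ (Fin d))}
  {y : EuclideanSpace ℝ (Fin d)} {f : EuclideanSpace ℝ (Fin d) → ℝ}

section
variable (h : IsCoordMetricOn g x₀ U) (hy : y ∈ U)
include h hy

theorem mul_inv : metricCoord g x₀ y * invMetricCoord g x₀ y = 1 :=
  Matrix.mul_nonsing_inv _ (h.det_ne y hy).isUnit

theorem inv_mul : invMetricCoord g x₀ y * metricCoord g x₀ y = 1 :=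
  Matrix.nonsing_inv_mul _ (h.det_ne y hy).isUnit

theorem transpose_eq : (metricCoord g x₀ y).transpose = metricCoord g x₀ y :=
  Matrix.ext fun i j ↦ h.symm y hy j i

theorem inv_symm (i j : Fin d) : invMetricCoord g x₀ y i j = invMetricCoord g x₀ y j i := by
  have e : (invMetricCoord g x₀ y).transpose = invMetricCoord g x₀ y := by
    rw [invMetricCoord, Matrix.transpose_nonsing_inv, h.transpose_eq hy]
  exact congrFun (congrFun e j) i

theorem sum_mul_inv (i j : Fin d) :
    ∑ k, metricCoord g x₀ y i k * invMetricCoord g x₀ y k j = if i = j then 1 else 0 := by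
  rw [← Matrix.mul_apply, h.mul_inv hy, Matrix.one_apply]

theorem sum_inv_mul (i j : Fin d) :
    ∑ k, invMetricCoord g x₀ y i k * metricCoord g x₀ y k j = if i = j then 1 else 0 := by
  rw [← Matrix.mul_apply, h.inv_mul hy, Matrix.one_apply]

theorem lower_raise (a : Fin d → ℝ) (i : Fin d) :
    ∑ k, metricCoord g x₀ y i k * ∑ l, invMetricCoord g x₀ y k l * a l = a i := by
  simp only [Finset.mul_sum]
  rw [Finset.sum_comm]
  simp only [← mul_assoc, ← Finset.sum_mul, h.sum_mul_inv hy]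
  simp

theorem smooth_inv (i j : Fin d) : SmoothAt (fun z ↦ invMetricCoord g x₀ z i j) y :=
  SmoothAt.matrix_inv (h.smooth y hy) (h.det_ne y hy) i j

theorem smooth_pderiv_metric (m i j : Fin d) :
    SmoothAt (pderiv m fun z ↦ metricCoord g x₀ z i j) y :=
  (h.smooth y hy i j).pderiv (h.subset hy) m

theorem eventually_mem : ∀ᶠ z in 𝓝[range (𝓡∂ d)] y, z ∈ U := h.mem_nhds y hy

theorem pderiv_metric_symm (m i j : Fin d) :
    pderiv m (fun z ↦ metricCoord g x₀ z i j) y = pderiv m (fun z ↦ metricCoord g x₀ z j i) y :=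
  pderiv_congr (h.subset hy) ((h.eventually_mem hy).mono fun z hz ↦ h.symm z hz i j) m

theorem smooth_christoffel (k i j : Fin d) : SmoothAt (christoffel g x₀ k i j) y := by
  refine contDiffWithinAt_const.mul (ContDiffWithinAt.sum fun l _ ↦ (h.smooth_inv hy k l).mul ?_)
  exact ((h.smooth_pderiv_metric hy _ _ _).add (h.smooth_pderiv_metric hy _ _ _)).sub
    (h.smooth_pderiv_metric hy _ _ _)

theorem christoffel_symm (k i j : Fin d) : christoffel g x₀ k i j y = christoffel g x₀ k j i y := by
  simp only [christoffel]
  congr 1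
  refine Finset.sum_congr rfl fun l _ ↦ ?_
  rw [h.pderiv_metric_symm hy l i j]
  ring

/-- The Christoffel symbols with all indices lowered. -/
theorem sum_christoffel_mul_metric (i j l : Fin d) :
    ∑ k, christoffel g x₀ k i j y * metricCoord g x₀ y k l
      = (1 / 2) * (pderiv i (fun z ↦ metricCoord g x₀ z j l) y
        + pderiv j (fun z ↦ metricCoord g x₀ z i l) y
        - pderiv l (fun z ↦ metricCoord g x₀ z i j) y) := by
  rw [← h.lower_raise hy (fun l ↦ pderiv i (fun z ↦ metricCoord g x₀ z j l) y
        + pderiv j (fun z ↦ metricCoord g x₀ z i l) y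
        - pderiv l (fun z ↦ metricCoord g x₀ z i j) y) l, Finset.mul_sum]
  refine Finset.sum_congr rfl fun k _ ↦ ?_
  rw [christoffel, h.symm y hy k l]
  ring

/-- The Levi-Civita connection is metric. -/
theorem pderiv_metric (m i j : Fin d) :
    pderiv m (fun z ↦ metricCoord g x₀ z i j) y
      = ∑ k, (christoffel g x₀ k m i y * metricCoord g x₀ y k j
        + christoffel g x₀ k m j y * metricCoord g x₀ y k i) := by
  rw [Finset.sum_add_distrib, h.sum_christoffel_mul_metric hy, h.sum_christoffel_mul_metric hy,
    h.pderiv_metric_symm hy m j i]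
  ring

/-- This is `∇g⁻¹ = 0`, obtained by differentiating `g⁻¹ g = 1` and using the metric compatibility
of the connection. -/
theorem pderiv_invMetric (m i j : Fin d) :
    pderiv m (fun z ↦ invMetricCoord g x₀ z i j) y
      = -∑ n, (christoffel g x₀ i m n y * invMetricCoord g x₀ y n j
        + christoffel g x₀ j m n y * invMetricCoord g x₀ y i n) := by
  have hy' := h.subset hy
  set D : Matrix (Fin d) (Fin d) ℝ :=
    Matrix.of fun i j ↦ pderiv m (fun z ↦ invMetricCoord g x₀ z i j) y with hD
  set Γ : Matrix (Fin d) (Fin d) ℝ := Matrix.of fun n k ↦ christoffel g x₀ n m k y with hΓ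
  have key : D * metricCoord g x₀ y + invMetricCoord g x₀ y *
      (Γ.transpose * metricCoord g x₀ y + metricCoord g x₀ y * Γ) = 0 := by
    ext i j
    have e : pderiv m (fun z ↦ ∑ k, invMetricCoord g x₀ z i k * metricCoord g x₀ z k j) y = 0 := by
      rw [pderiv_congr hy' ((h.eventually_mem hy).mono fun z hz ↦ h.sum_inv_mul hz i j),
        pderiv_const]
    rw [pderiv_sum _ hy' fun k _ ↦ (h.smooth_inv hy i k).mul (h.smooth y hy k j)] at e
    simp only [Matrix.add_apply, Matrix.mul_apply, Matrix.zero_apply, ← Finset.sum_add_distrib]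
    rw [← e]
    refine Finset.sum_congr rfl fun k _ ↦ ?_
    rw [pderiv_mul hy' (h.smooth_inv hy i k) (h.smooth y hy k j), h.pderiv_metric hy]
    simp only [hD, hΓ, Matrix.of_apply, Matrix.transpose_apply]
    congr 2
    refine Finset.sum_congr rfl fun n _ ↦ ?_
    rw [h.symm y hy n k]
    ring
  have key2 : D = -(invMetricCoord g x₀ y * Γ.transpose + Γ * invMetricCoord g x₀ y) := by
    have e := congrArg (· * invMetricCoord g x₀ y) key
    simp only [Matrix.add_mul, Matrix.mul_add, Matrix.mul_assoc, h.mul_inv hy, Matrix.mul_one,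
      Matrix.zero_mul] at e
    rw [← Matrix.mul_assoc _ (metricCoord g x₀ y), h.inv_mul hy, Matrix.one_mul] at e
    exact eq_neg_of_add_eq_zero_left e
  have e := congrFun (congrFun key2 i) j
  simp only [hD, hΓ, Matrix.of_apply, Matrix.neg_apply, Matrix.add_apply, Matrix.mul_apply,
    Matrix.transpose_apply] at e
  rw [e, ← Finset.sum_add_distrib]
  congr 1
  refine Finset.sum_congr rfl fun n _ ↦ ?_
  ring

theorem smooth_riemann (i j k l : Fin d) : SmoothAt (riemann g x₀ i j k l) y := by
  have hy' := h.subset hy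
  refine (((h.smooth_christoffel hy _ _ _).pderiv hy' _).sub
    ((h.smooth_christoffel hy _ _ _).pderiv hy' _)).add (ContDiffWithinAt.sum fun m _ ↦ ?_)
  exact ((h.smooth_christoffel hy _ _ _).mul (h.smooth_christoffel hy _ _ _)).sub
    ((h.smooth_christoffel hy _ _ _).mul (h.smooth_christoffel hy _ _ _))

theorem smooth_ricci (i j : Fin d) : SmoothAt (ricci g x₀ i j) y :=
  ContDiffWithinAt.sum fun _ _ ↦ h.smooth_riemann hy _ _ _ _

theorem smooth_schoutenTrace : SmoothAt (schoutenTrace g x₀) y :=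
  ContDiffWithinAt.div_const (ContDiffWithinAt.sum fun _ _ ↦ ContDiffWithinAt.sum fun _ _ ↦
    (h.smooth_inv hy _ _).mul (h.smooth_ricci hy _ _)) _

theorem smooth_schouten (i j : Fin d) : SmoothAt (schouten g x₀ i j) y :=
  ((h.smooth_ricci hy i j).sub ((h.smooth_schoutenTrace hy).mul (h.smooth y hy i j))).div_const _

theorem smooth_hessian (hf : SmoothAt f y) (i j : Fin d) : SmoothAt (hessian g x₀ f i j) y :=
  ((hf.pderiv (h.subset hy) j).pderiv (h.subset hy) i).sub (ContDiffWithinAt.sum fun k _ ↦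
    (h.smooth_christoffel hy k i j).mul (hf.pderiv (h.subset hy) k))

theorem smooth_traceHessian (hf : SmoothAt f y) : SmoothAt (traceHessian g x₀ f) y :=
  ContDiffWithinAt.sum fun _ _ ↦ ContDiffWithinAt.sum fun _ _ ↦
    (h.smooth_inv hy _ _).mul (h.smooth_hessian hy hf _ _)

theorem smooth_gradSq (hf : SmoothAt f y) : SmoothAt (gradSq g x₀ f) y :=
  ContDiffWithinAt.sum fun _ _ ↦ ContDiffWithinAt.sum fun _ _ ↦
    ((h.smooth_inv hy _ _).mul (hf.pderiv (h.subset hy) _)).mul (hf.pderiv (h.subset hy) _)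

/-- The derivative of the squared length of the gradient. -/
theorem pderiv_gradSq (hf : SmoothAt f y) (m : Fin d) :
    pderiv m (gradSq g x₀ f) y
      = 2 * ∑ i, ∑ j, hessian g x₀ f m i y * invMetricCoord g x₀ y i j * pderiv j f y := by
  have hy' := h.subset hy
  have hp : ∀ i, SmoothAt (pderiv i f) y := fun i ↦ hf.pderiv hy' i
  have e : pderiv m (gradSq g x₀ f) y = ∑ i, ∑ j,
      (pderiv m (fun z ↦ invMetricCoord g x₀ z i j) y * pderiv i f y * pderiv j f y
        + invMetricCoord g x₀ y i j * pderiv m (pderiv i f) y * pderiv j f y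
        + invMetricCoord g x₀ y i j * pderiv i f y * pderiv m (pderiv j f) y) := by
    unfold gradSq
    rw [pderiv_sum _ hy' fun i _ ↦ ContDiffWithinAt.sum fun j _ ↦
      ((h.smooth_inv hy i j).mul (hp i)).mul (hp j)]
    refine Finset.sum_congr rfl fun i _ ↦ ?_
    rw [pderiv_sum _ hy' fun j _ ↦ ((h.smooth_inv hy i j).mul (hp i)).mul (hp j)]
    refine Finset.sum_congr rfl fun j _ ↦ ?_
    rw [pderiv_mul hy' ((h.smooth_inv hy i j).mul (hp i)) (hp j),
      pderiv_mul hy' (h.smooth_inv hy i j) (hp i)]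
    ring
  -- The two Christoffel terms of `∂g⁻¹` become equal after relabelling indices. They supply exactly
  -- the corrections that turn the second derivatives into Hessians.
  have e1 : ∑ i, ∑ j, pderiv m (fun z ↦ invMetricCoord g x₀ z i j) y * pderiv i f y * pderiv j f y
      = -(2 * ∑ i, ∑ j, ∑ k, christoffel g x₀ k m i y * pderiv k f y
          * invMetricCoord g x₀ y i j * pderiv j f y) := by
    have a1 : ∑ i, ∑ j, ∑ n, christoffel g x₀ i m n y * invMetricCoord g x₀ y n j
          * pderiv i f y * pderiv j f y
        = ∑ i, ∑ j, ∑ k, christoffel g x₀ k m i y * pderiv k f y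
          * invMetricCoord g x₀ y i j * pderiv j f y := by
      rw [Finset.sum_comm]
      rw [Finset.sum_congr rfl fun j _ ↦ Finset.sum_comm]
      rw [Finset.sum_comm]
      refine Finset.sum_congr rfl fun _ _ ↦ Finset.sum_congr rfl fun _ _ ↦
        Finset.sum_congr rfl fun _ _ ↦ by ring
    have a2 : ∑ i, ∑ j, ∑ n, christoffel g x₀ j m n y * invMetricCoord g x₀ y i n
          * pderiv i f y * pderiv j f y
        = ∑ i, ∑ j, ∑ k, christoffel g x₀ k m i y * pderiv k f y
          * invMetricCoord g x₀ y i j * pderiv j f y := by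
      rw [Finset.sum_congr rfl fun i _ ↦ Finset.sum_comm]
      rw [Finset.sum_comm]
      refine Finset.sum_congr rfl fun n _ ↦ Finset.sum_congr rfl fun i _ ↦
        Finset.sum_congr rfl fun _ _ ↦ ?_
      rw [h.inv_symm hy i n]
      ring
    rw [two_mul]
    nth_rewrite 1 [← a1]
    rw [← a2]
    simp only [h.pderiv_invMetric hy, ← Finset.sum_add_distrib, ← Finset.sum_neg_distrib, neg_mul,
      Finset.sum_mul, add_mul]
  have e2 : ∑ i, ∑ j, invMetricCoord g x₀ y i j * pderiv i f y * pderiv m (pderiv j f) y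
      = ∑ i, ∑ j, invMetricCoord g x₀ y i j * pderiv m (pderiv i f) y * pderiv j f y := by
    rw [Finset.sum_comm]
    refine Finset.sum_congr rfl fun i _ ↦ Finset.sum_congr rfl fun j _ ↦ ?_
    rw [h.inv_symm hy i j]
    ring
  rw [e]
  simp only [Finset.sum_add_distrib]
  rw [e1, e2]
  simp only [hessian, sub_mul, Finset.sum_sub_distrib, Finset.sum_mul]
  have e3 : ∑ i, ∑ j, invMetricCoord g x₀ y i j * pderiv m (pderiv i f) y * pderiv j f y
      = ∑ i, ∑ j, pderiv m (pderiv i f) y * invMetricCoord g x₀ y i j * pderiv j f y :=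
    Finset.sum_congr rfl fun i _ ↦ Finset.sum_congr rfl fun j _ ↦ by ring
  rw [e3]
  ring

end

end IsCoordMetricOn

end CoordinateGeometry

/-! ### Curvature of `f⁻² g` and the almost Einstein equation. -/

section ConformalChange

variable {d : ℕ} [NeZero d]
  {M : Type*} [TopologicalSpace M] [ChartedSpace (EuclideanHalfSpace d) M]

namespace IsCoordMetricOn

variable {g g' : BilinField d M} {x₀ : M} {U : Set (EuclideanSpace ℝ (Fin d))}
  {y : EuclideanSpace ℝ (Fin d)} {f : EuclideanSpace ℝ (Fin d) → ℝ}

section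
variable (h : IsCoordMetricOn g x₀ U) (hf : ∀ z ∈ U, SmoothAt f z) (hf0 : ∀ z ∈ U, f z ≠ 0)
  (hg' : ∀ z ∈ U, metricCoord g' x₀ z = (f z ^ 2)⁻¹ • metricCoord g x₀ z) (hy : y ∈ U)
include h hf hf0 hg' hy

/-- The covector `-df / f` is the logarithmic derivative of the conformal factor `f⁻¹`. It plays the
role of `a` in `conformalDifference`. -/
theorem pderiv_metric_conformal (m i j : Fin d) :
    pderiv m (fun z ↦ metricCoord g' x₀ z i j) y
      = (f y ^ 2)⁻¹ * (pderiv m (fun z ↦ metricCoord g x₀ z i j) y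
        + 2 * -(pderiv m f y / f y) * metricCoord g x₀ y i j) := by
  have hy' := h.subset hy
  have h0 := hf0 y hy
  have hs := hf y hy
  have e : (fun z ↦ metricCoord g' x₀ z i j) =ᶠ[𝓝[range (𝓡∂ d)] y]
      fun z ↦ (f z * f z)⁻¹ * metricCoord g x₀ z i j := by
    filter_upwards [h.eventually_mem hy] with z hz
    rw [hg' z hz, Matrix.smul_apply, smul_eq_mul, pow_two]
  have hi : SmoothAt (fun z ↦ (f z * f z)⁻¹) y := (hs.mul hs).inv (mul_ne_zero h0 h0)
  rw [pderiv_congr hy' e, pderiv_mul hy' hi (h.smooth y hy i j),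
    pderiv_inv hy' (hs.mul hs) (mul_ne_zero h0 h0), pderiv_mul hy' hs hs]
  field_simp
  ring

omit hf in
theorem invMetric_conformal :
    invMetricCoord g' x₀ y = (f y ^ 2) • invMetricCoord g x₀ y := by
  rw [invMetricCoord, hg' y hy]
  refine Matrix.inv_eq_left_inv ?_
  rw [Matrix.smul_mul, Matrix.mul_smul, smul_smul, h.inv_mul hy,
    mul_inv_cancel₀ (pow_ne_zero 2 (hf0 y hy)), one_smul]

theorem christoffel_conformal (k i j : Fin d) :
    christoffel g' x₀ k i j y = christoffel g x₀ k i j y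
      + conformalDifference (fun i j ↦ metricCoord g x₀ y i j) (fun l ↦ -(pderiv l f y / f y))
        (fun k ↦ ∑ l, invMetricCoord g x₀ y k l * -(pderiv l f y / f y)) k i j := by
  have h0 := hf0 y hy
  have hs : ∀ i j k, ∑ l, invMetricCoord g x₀ y k l
      * (-(pderiv i f y / f y) * metricCoord g x₀ y j l)
      = if k = j then -(pderiv i f y / f y) else 0 := fun i j k ↦ by
    have : ∀ l, invMetricCoord g x₀ y k l * (-(pderiv i f y / f y) * metricCoord g x₀ y j l)
      = -(pderiv i f y / f y) * (invMetricCoord g x₀ y k l * metricCoord g x₀ y l j) := fun l ↦ by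
        rw [h.symm y hy j l]; ring
    simp only [this, ← Finset.mul_sum, h.sum_inv_mul hy]
    split_ifs <;> simp
  -- The Kronecker deltas are expanded back into contractions with the inverse metric, so that both
  -- sides are sums over the same `l` and can be compared termwise.
  rw [conformalDifference, ← hs i j k, ← hs j i k, Finset.mul_sum]
  unfold christoffel
  rw [Finset.mul_sum, Finset.mul_sum, ← Finset.sum_add_distrib, ← Finset.sum_sub_distrib,
    ← Finset.sum_add_distrib]
  refine Finset.sum_congr rfl fun l _ ↦ ?_
  rw [h.invMetric_conformal hf0 hg' hy, h.pderiv_metric_conformal hf hf0 hg' hy,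
    h.pderiv_metric_conformal hf hf0 hg' hy, h.pderiv_metric_conformal hf hf0 hg' hy]
  simp only [Matrix.smul_apply, smul_eq_mul]
  field_simp
  ring

/-- The Ricci curvature of `f⁻² g`. -/
theorem ricci_conformal (i j : Fin d) :
    ricci g' x₀ i j y = ricci g x₀ i j y + (d - 2) * (hessian g x₀ f i j y / f y)
      + metricCoord g x₀ y i j * (traceHessian g x₀ f y / f y
        - (d - 1) * (gradSq g x₀ f y / f y ^ 2)) := by
  have hy' := h.subset hy
  have h0 := hf0 y hy
  set a : Fin d → EuclideanSpace ℝ (Fin d) → ℝ := fun l z ↦ -(pderiv l f z / f z) with ha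
  set v : Fin d → EuclideanSpace ℝ (Fin d) → ℝ :=
    fun k z ↦ ∑ l, invMetricCoord g x₀ z k l * a l z with hvdef
  have hsa : ∀ l, SmoothAt (a l) y := fun l ↦
    (((hf y hy).pderiv hy' l).div (hf y hy) h0).neg
  have hsv : ∀ k, SmoothAt (v k) y := fun k ↦
    ContDiffWithinAt.sum fun l _ ↦ (h.smooth_inv hy k l).mul (hsa l)
  have hda : ∀ l i, pderiv l (a i) y
      = -(pderiv l (pderiv i f) y / f y) + pderiv l f y * pderiv i f y / f y ^ 2 := fun l i ↦ by
    have e : a i = fun z ↦ -(pderiv i f z * (f z)⁻¹) := rfl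
    have hi : SmoothAt (fun z ↦ (f z)⁻¹) y := (hf y hy).inv h0
    rw [e, pderiv_neg hy', pderiv_mul hy' ((hf y hy).pderiv hy' i) hi,
      pderiv_inv hy' (hf y hy) h0]
    field_simp
    ring
  have hda_symm : ∀ l i, pderiv l (a i) y = pderiv i (a l) y := fun l i ↦ by
    rw [hda, hda, pderiv_comm hy' (hf y hy) l i]
    ring
  have hv : ∀ z ∈ U, ∀ i, ∑ k, metricCoord g x₀ z i k * v k z = a i z := fun z hz i ↦
    h.lower_raise hz (fun l ↦ a l z) i
  have hdv : ∀ l i, ∑ k, (pderiv l (fun z ↦ metricCoord g x₀ z i k) y * v k y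
      + metricCoord g x₀ y i k * pderiv l (v k) y) = pderiv l (a i) y := fun l i ↦ by
    rw [← pderiv_congr hy' ((h.eventually_mem hy).mono fun z hz ↦ hv z hz i),
      pderiv_sum _ hy' fun k _ ↦ (h.smooth y hy i k).mul (hsv k)]
    exact Finset.sum_congr rfl fun k _ ↦ (pderiv_mul hy' (h.smooth y hy i k) (hsv k) l).symm
  -- The formula for the symbols is needed as an equality of germs, since the curvature
  -- differentiates it.
  have hC : ∀ k i j, christoffel g' x₀ k i j =ᶠ[𝓝[range (𝓡∂ d)] y] fun z ↦
      christoffel g x₀ k i j z + ((if k = j then a i z else 0) + (if k = i then a j z else 0)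
        - metricCoord g x₀ z i j * v k z) := fun k i j ↦ by
    filter_upwards [h.eventually_mem hy] with z hz
    rw [h.christoffel_conformal hf hf0 hg' hz]
    rfl
  have hite : ∀ (p : Prop) [Decidable p] (l : Fin d),
      SmoothAt (fun z ↦ if p then a l z else 0) y := fun p _ l ↦ by
    by_cases hp : p
    · simpa only [hp, if_true] using hsa l
    · simpa only [hp, if_false] using contDiffWithinAt_const
  have hpite : ∀ (p : Prop) [Decidable p] (l m : Fin d),
      pderiv m (fun z ↦ if p then a l z else 0) y = if p then pderiv m (a l) y else 0 := by
    intro p _ l m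
    by_cases hp : p
    · simp only [hp, if_true]
    · simp only [hp, if_false, pderiv_const]
  have hdC : ∀ l k i j, pderiv l (christoffel g' x₀ k i j) y = pderiv l (christoffel g x₀ k i j) y
      + ((if k = j then pderiv l (a i) y else 0) + (if k = i then pderiv l (a j) y else 0)
        - (pderiv l (fun z ↦ metricCoord g x₀ z i j) y * v k y
          + metricCoord g x₀ y i j * pderiv l (v k) y)) := fun l k i j ↦ by
    rw [pderiv_congr hy' (hC k i j), pderiv_add hy' (h.smooth_christoffel hy k i j)
      (((hite _ i).add (hite _ j)).sub ((h.smooth y hy i j).mul (hsv k))),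
      pderiv_sub hy' ((hite _ i).add (hite _ j)) ((h.smooth y hy i j).mul (hsv k)),
      pderiv_add hy' (hite _ i) (hite _ j), hpite, hpite,
      pderiv_mul hy' (h.smooth y hy i j) (hsv k)]
  have key := ricci_conformal_algebra (G := fun i j ↦ metricCoord g x₀ y i j)
    (Γ := fun k i j ↦ christoffel g x₀ k i j y)
    (DG := fun m i j ↦ pderiv m (fun z ↦ metricCoord g x₀ z i j) y)
    (a := fun i ↦ a i y) (v := fun k ↦ v k y) (Da := fun l i ↦ pderiv l (a i) y)
    (Dv := fun l k ↦ pderiv l (v k) y) (h.symm y hy) (fun k i j ↦ h.christoffel_symm hy k i j)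
    hda_symm (hv y hy) hdv (h.pderiv_metric hy) i j
  have hR : ricci g' x₀ i j y - ricci g x₀ i j y
      = ∑ k, (((if k = j then pderiv k (a i) y else 0) + (if k = i then pderiv k (a j) y else 0)
          - (pderiv k (fun z ↦ metricCoord g x₀ z i j) y * v k y
            + metricCoord g x₀ y i j * pderiv k (v k) y))
        - ((if k = j then pderiv i (a k) y else 0) + pderiv i (a j) y
          - (pderiv i (fun z ↦ metricCoord g x₀ z k j) y * v k y
            + metricCoord g x₀ y k j * pderiv i (v k) y))
        + ∑ m, (christoffel g' x₀ k k m y * christoffel g' x₀ m i j y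
            - christoffel g' x₀ k i m y * christoffel g' x₀ m k j y))
        - ∑ k, ∑ m, (christoffel g x₀ k k m y * christoffel g x₀ m i j y
            - christoffel g x₀ k i m y * christoffel g x₀ m k j y) := by
    unfold ricci riemann
    rw [← Finset.sum_sub_distrib, ← Finset.sum_sub_distrib]
    refine Finset.sum_congr rfl fun k _ ↦ ?_
    rw [hdC, hdC]
    simp only [if_true]
    ring
  have hΓ : ∀ k i j, christoffel g' x₀ k i j y = christoffel g x₀ k i j y
      + conformalDifference (fun i j ↦ metricCoord g x₀ y i j) (fun l ↦ a l y)
        (fun k ↦ v k y) k i j := fun k i j ↦ h.christoffel_conformal hf hf0 hg' hy k i j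
  simp only [hΓ] at hR
  rw [key] at hR
  -- The quadratic term of `∇a` cancels the `-a i * a j` in the algebraic identity.
  have hess : ∀ i j, pderiv i (a j) y - ∑ m, christoffel g x₀ m i j y * a m y
      = -(hessian g x₀ f i j y / f y) + pderiv i f y * pderiv j f y / f y ^ 2 := fun i j ↦ by
    rw [hda, hessian]
    have : ∑ m, christoffel g x₀ m i j y * a m y
        = -((∑ m, christoffel g x₀ m i j y * pderiv m f y) / f y) := by
      rw [Finset.sum_div, ← Finset.sum_neg_distrib]
      exact Finset.sum_congr rfl fun m _ ↦ by simp only [ha]; ring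
    rw [this]
    ring
  have hN : ∑ m, a m y * v m y = gradSq g x₀ f y / f y ^ 2 := by
    simp only [hvdef, ha, gradSq, Finset.mul_sum, Finset.sum_div]
    refine Finset.sum_congr rfl fun m _ ↦ Finset.sum_congr rfl fun l _ ↦ ?_
    field_simp
  -- The divergence of `v` is the trace of `∇a`, because the inverse metric is parallel.
  have hdiv : ∑ k, pderiv k (v k) y + ∑ k, ∑ m, christoffel g x₀ k k m y * v m y
      = -(traceHessian g x₀ f y / f y) + gradSq g x₀ f y / f y ^ 2 := by
    have e1 : -(traceHessian g x₀ f y / f y) + gradSq g x₀ f y / f y ^ 2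
        = ∑ k, ∑ l, invMetricCoord g x₀ y k l
          * (pderiv k (a l) y - ∑ m, christoffel g x₀ m k l y * a m y) := by
      simp only [hess, traceHessian, gradSq, Finset.sum_div, ← Finset.sum_neg_distrib,
        ← Finset.sum_add_distrib]
      exact Finset.sum_congr rfl fun m _ ↦ Finset.sum_congr rfl fun l _ ↦ by ring
    have e2 : ∀ k, pderiv k (v k) y = ∑ l, (pderiv k (fun z ↦ invMetricCoord g x₀ z k l) y * a l y
        + invMetricCoord g x₀ y k l * pderiv k (a l) y) := fun k ↦ by
      simp only [hvdef]
      rw [pderiv_sum _ hy' fun l _ ↦ (h.smooth_inv hy k l).mul (hsa l)]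
      exact Finset.sum_congr rfl fun l _ ↦ pderiv_mul hy' (h.smooth_inv hy k l) (hsa l) k
    have e3 : ∑ k, ∑ l, pderiv k (fun z ↦ invMetricCoord g x₀ z k l) y * a l y
        = -(∑ k, ∑ m, christoffel g x₀ k k m y * v m y
          + ∑ k, ∑ l, invMetricCoord g x₀ y k l * ∑ m, christoffel g x₀ m k l y * a m y) := by
      simp only [h.pderiv_invMetric hy, hvdef, neg_mul, Finset.sum_neg_distrib, add_mul,
        Finset.sum_add_distrib, Finset.sum_mul, Finset.mul_sum]
      congr 2
      · refine Finset.sum_congr rfl fun k _ ↦ ?_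
        rw [Finset.sum_comm]
        exact Finset.sum_congr rfl fun m _ ↦ Finset.sum_congr rfl fun l _ ↦ by ring
      · refine Finset.sum_congr rfl fun k _ ↦ ?_
        rw [Finset.sum_comm]
        exact Finset.sum_congr rfl fun m _ ↦ Finset.sum_congr rfl fun l _ ↦ by ring
    rw [e1]
    simp only [e2, mul_sub, Finset.sum_sub_distrib, Finset.sum_add_distrib]
    rw [e3]
    ring
  rw [hdiv, hN, hess i j, Fintype.card_fin] at hR
  have e := sub_eq_iff_eq_add.1 hR
  rw [e]
  simp only [ha]
  field_simp
  ring

end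

section
variable (h : IsCoordMetricOn g x₀ U) (hy : y ∈ U)
include h hy

theorem sum_inv_mul_metric :
    ∑ i, ∑ j, invMetricCoord g x₀ y i j * metricCoord g x₀ y i j = d := by
  have : ∀ i, ∑ j, invMetricCoord g x₀ y i j * metricCoord g x₀ y i j = 1 := fun i ↦ by
    have e := h.sum_inv_mul hy i i
    rw [if_pos rfl] at e
    rw [← e]
    exact Finset.sum_congr rfl fun j _ ↦ by rw [h.symm y hy i j]
  simp [this]

omit h hy in
theorem ricci_eq_schouten (hd : 3 ≤ d) (i j : Fin d) :
    ricci g x₀ i j y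
      = (d - 2) * schouten g x₀ i j y + schoutenTrace g x₀ y * metricCoord g x₀ y i j := by
  have : (d : ℝ) - 2 ≠ 0 := by
    have : (3 : ℝ) ≤ d := by exact_mod_cast hd
    linarith
  rw [schouten]
  field_simp
  ring

omit h hy in
theorem sum_inv_mul_ricci (hd : 3 ≤ d) :
    ∑ i, ∑ j, invMetricCoord g x₀ y i j * ricci g x₀ i j y
      = 2 * (d - 1) * schoutenTrace g x₀ y := by
  have : (d : ℝ) - 1 ≠ 0 := by
    have : (3 : ℝ) ≤ d := by exact_mod_cast hd
    linarith
  rw [schoutenTrace, scalarCurvature]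
  field_simp

/-- The numerator has trace `(2 (d - 1) - d) J = (d - 2) J`. -/
theorem sum_inv_mul_schouten (hd : 3 ≤ d) :
    ∑ i, ∑ j, invMetricCoord g x₀ y i j * schouten g x₀ i j y = schoutenTrace g x₀ y := by
  have h2 : (d : ℝ) - 2 ≠ 0 := by
    have : (3 : ℝ) ≤ d := by exact_mod_cast hd
    linarith
  have e : ∑ i, ∑ j, invMetricCoord g x₀ y i j * schouten g x₀ i j y
      = ((∑ i, ∑ j, invMetricCoord g x₀ y i j * ricci g x₀ i j y)
        - schoutenTrace g x₀ y * ∑ i, ∑ j, invMetricCoord g x₀ y i j * metricCoord g x₀ y i j)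
        / (d - 2) := by
    simp only [schouten, Finset.mul_sum, ← Finset.sum_sub_distrib, Finset.sum_div]
    exact Finset.sum_congr rfl fun m _ ↦ Finset.sum_congr rfl fun l _ ↦ by ring
  rw [e, sum_inv_mul_ricci hd, h.sum_inv_mul_metric hy]
  field_simp
  ring

/-- The trace of the equation `∇∇f + ρ g + f P = 0`. -/
theorem traceHessian_of_almostEinstein (hd : 3 ≤ d) {ρ : ℝ}
    (hE : ∀ i j, hessian g x₀ f i j y + metricCoord g x₀ y i j * ρ
      + schouten g x₀ i j y * f y = 0) :
    traceHessian g x₀ f y = -(d * ρ) - schoutenTrace g x₀ y * f y := by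
  have e : ∀ i j, hessian g x₀ f i j y
      = -(metricCoord g x₀ y i j * ρ) - schouten g x₀ i j y * f y := fun i j ↦ by
    linarith [hE i j]
  have e1 : traceHessian g x₀ f y
      = -((∑ i, ∑ j, invMetricCoord g x₀ y i j * metricCoord g x₀ y i j) * ρ)
        - (∑ i, ∑ j, invMetricCoord g x₀ y i j * schouten g x₀ i j y) * f y := by
    simp only [traceHessian, e, Finset.sum_mul, ← Finset.sum_neg_distrib,
      ← Finset.sum_sub_distrib]
    exact Finset.sum_congr rfl fun m _ ↦ Finset.sum_congr rfl fun l _ ↦ by ring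
  rw [e1, h.sum_inv_mul_metric hy, h.sum_inv_mul_schouten hy hd]

end

section
variable (hd : 3 ≤ d) (h : IsCoordMetricOn g x₀ U) (hf : ∀ z ∈ U, SmoothAt f z)
  (hf0 : ∀ z ∈ U, f z ≠ 0)
  (hg' : ∀ z ∈ U, metricCoord g' x₀ z = (f z ^ 2)⁻¹ • metricCoord g x₀ z) (hy : y ∈ U)
include hd h hf hf0 hg' hy

/-- The almost Einstein equation for `f`, of length one, makes `f⁻² g` a normalised Einstein
metric. -/
theorem einstein_of_almostEinstein {ρ : ℝ}
    (hE : ∀ i j, hessian g x₀ f i j y + metricCoord g x₀ y i j * ρ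
      + schouten g x₀ i j y * f y = 0)
    (hN : gradSq g x₀ f y + 2 * (f y * ρ) = 1) (i j : Fin d) :
    ricci g' x₀ i j y = -((d : ℝ) - 1) * metricCoord g' x₀ y i j := by
  have h0 := hf0 y hy
  have e : hessian g x₀ f i j y
      = -(metricCoord g x₀ y i j * ρ) - schouten g x₀ i j y * f y := by
    linarith [hE i j]
  have eN : gradSq g x₀ f y = 1 - 2 * (f y * ρ) := by linarith
  -- The Schouten terms and their trace cancel. The coefficient of `g` that survives is `-(d - 1)
  -- (|df|² + 2 f ρ) / f²`.
  rw [h.ricci_conformal hf hf0 hg' hy, ricci_eq_schouten hd, e,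
    h.traceHessian_of_almostEinstein hy hd hE, eN, hg' y hy, Matrix.smul_apply, smul_eq_mul]
  field_simp
  ring

/-- If `f⁻² g` is a normalised Einstein metric, the length of the corresponding tractor is one. -/
theorem gradSq_of_einstein
    (hE : ∀ i j, ricci g' x₀ i j y = -((d : ℝ) - 1) * metricCoord g' x₀ y i j) :
    gradSq g x₀ f y + 2 * (f y * (-(1 / (d : ℝ)) * (schoutenTrace g x₀ y * f y
      + traceHessian g x₀ f y))) = 1 := by
  have h0 := hf0 y hy
  have h3 : (3 : ℝ) ≤ d := by exact_mod_cast hd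
  -- The Einstein equation is contracted with `g^ij`. Its trace is `d - 1` times the asserted
  -- relation, up to a nonzero multiple.
  have e : ∀ i j, invMetricCoord g x₀ y i j * ricci g x₀ i j y
      + (d - 2) / f y * (invMetricCoord g x₀ y i j * hessian g x₀ f i j y)
      + (traceHessian g x₀ f y / f y - (d - 1) * (gradSq g x₀ f y / f y ^ 2) + (d - 1) / f y ^ 2)
        * (invMetricCoord g x₀ y i j * metricCoord g x₀ y i j) = 0 := fun i j ↦ by
    have := hE i j
    rw [h.ricci_conformal hf hf0 hg' hy, hg' y hy, Matrix.smul_apply, smul_eq_mul] at this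
    linear_combination invMetricCoord g x₀ y i j * this
  have e2 := Finset.sum_congr rfl fun i (_ : i ∈ Finset.univ) ↦
    Finset.sum_congr rfl fun j (_ : j ∈ Finset.univ) ↦ e i j
  simp only [Finset.sum_add_distrib, ← Finset.mul_sum, sum_inv_mul_ricci hd,
    h.sum_inv_mul_metric hy, Finset.sum_const_zero] at e2
  rw [← traceHessian] at e2
  have hd1 : (d : ℝ) - 1 ≠ 0 := by linarith
  have hd0 : (d : ℝ) ≠ 0 := by linarith
  have e3 : (d - 1) * ((d : ℝ) * gradSq g x₀ f y
      - 2 * f y * (schoutenTrace g x₀ y * f y + traceHessian g x₀ f y) - d) = 0 := by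
    field_simp at e2
    linear_combination -e2
  have e4 := (mul_eq_zero.1 e3).resolve_left hd1
  field_simp
  linear_combination e4

/-- A normalised Einstein metric `f⁻² g` gives rise to a solution of the almost Einstein
equation. -/
theorem almostEinstein_of_einstein
    (hE : ∀ i j, ricci g' x₀ i j y = -((d : ℝ) - 1) * metricCoord g' x₀ y i j) (i j : Fin d) :
    hessian g x₀ f i j y + metricCoord g x₀ y i j * (-(1 / (d : ℝ)) * (schoutenTrace g x₀ y * f y
      + traceHessian g x₀ f y)) + schouten g x₀ i j y * f y = 0 := by
  have h0 := hf0 y hy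
  have h3 : (3 : ℝ) ≤ d := by exact_mod_cast hd
  have hd0 : (d : ℝ) ≠ 0 := by linarith
  have hd2 : (d : ℝ) - 2 ≠ 0 := by linarith
  have hN := h.gradSq_of_einstein hd hf hf0 hg' hy hE
  have e := hE i j
  rw [h.ricci_conformal hf hf0 hg' hy, ricci_eq_schouten hd, hg' y hy, Matrix.smul_apply,
    smul_eq_mul] at e
  set N := gradSq g x₀ f y
  set ρ := -(1 / (d : ℝ)) * (schoutenTrace g x₀ y * f y + traceHessian g x₀ f y) with hρ
  -- Eliminating `|df|²` by the length and `tr ∇∇f` by the choice of `ρ` reduces the Einstein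
  -- equation to `f (d - 2)` times the almost Einstein expression.
  have eN : N = 1 - 2 * (f y * ρ) := by linarith
  have eL : traceHessian g x₀ f y = -(d * ρ) - schoutenTrace g x₀ y * f y := by
    rw [hρ]
    field_simp
    ring
  rw [eN, eL] at e
  have e2 : ((d : ℝ) - 2) * (hessian g x₀ f i j y + metricCoord g x₀ y i j * ρ
      + schouten g x₀ i j y * f y) = 0 := by
    field_simp at e
    have e' : f y * (((d : ℝ) - 2) * (hessian g x₀ f i j y + metricCoord g x₀ y i j * ρ
      + schouten g x₀ i j y * f y)) = 0 := by
      linear_combination e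
    exact (mul_eq_zero.1 e').resolve_left h0
  exact (mul_eq_zero.1 e2).resolve_left hd2

end

/-- The last component of the parallel tractor equation follows from the others and the
constancy of the length. -/
theorem pderiv_rho (h : IsCoordMetricOn g x₀ U) (hf : ∀ z ∈ U, SmoothAt f z) (hy : y ∈ U)
    (h0 : f y ≠ 0) {ρ : EuclideanSpace ℝ (Fin d) → ℝ} (hρ : SmoothAt ρ y)
    (hN : ∀ z ∈ U, gradSq g x₀ f z + 2 * (f z * ρ z) = 1)
    (hE : ∀ i j, hessian g x₀ f i j y + metricCoord g x₀ y i j * ρ y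
      + schouten g x₀ i j y * f y = 0) (i : Fin d) :
    pderiv i ρ y - ∑ j, ∑ k, schouten g x₀ i j y * invMetricCoord g x₀ y j k * pderiv k f y
      = 0 := by
  have hy' := h.subset hy
  have e := pderiv_congr hy' ((h.eventually_mem hy).mono hN) i
  rw [pderiv_const, pderiv_add hy' (h.smooth_gradSq hy (hf y hy))
    (contDiffWithinAt_const.mul ((hf y hy).mul hρ)), pderiv_const_mul hy' ((hf y hy).mul hρ),
    pderiv_mul hy' (hf y hy) hρ, h.pderiv_gradSq hy (hf y hy)] at e
  -- In the derivative of the length, the almost Einstein equation replaces the Hessian. The terms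
  -- `ρ df` then cancel, and everything left carries a factor `f`.
  have e1 : ∀ j k, hessian g x₀ f i j y * invMetricCoord g x₀ y j k * pderiv k f y
      = -ρ y * (metricCoord g x₀ y i j * (invMetricCoord g x₀ y j k * pderiv k f y))
        - f y * (schouten g x₀ i j y * invMetricCoord g x₀ y j k * pderiv k f y) := fun j k ↦ by
    linear_combination (invMetricCoord g x₀ y j k * pderiv k f y) * hE i j
  simp only [e1, Finset.sum_sub_distrib, ← Finset.mul_sum] at e
  rw [h.lower_raise hy (fun k ↦ pderiv k f y)] at e
  have e2 : f y * (pderiv i ρ y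
      - ∑ j, ∑ k, schouten g x₀ i j y * invMetricCoord g x₀ y j k * pderiv k f y) = 0 := by
    linear_combination e / 2
  exact (mul_eq_zero.1 e2).resolve_left h0

end IsCoordMetricOn

end ConformalChange

/-! ### Coordinate frames and the components of global tensors. -/

section Charts

variable {d : ℕ} [NeZero d]
  {M : Type*} [TopologicalSpace M] [ChartedSpace (EuclideanHalfSpace d) M]
  [IsManifold (𝓡∂ d) ∞ M] {x₀ : M} {y : EuclideanSpace ℝ (Fin d)}

omit [IsManifold (𝓡∂ d) ∞ M] in
theorem mem_range_of_mem_target (hy : y ∈ (extChartAt (𝓡∂ d) x₀).target) : y ∈ range (𝓡∂ d) :=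
  extChartAt_target_subset_range x₀ hy

theorem mdifferentiableWithinAt_pt (hy : y ∈ (extChartAt (𝓡∂ d) x₀).target) :
    MDifferentiableWithinAt 𝓘(ℝ, EuclideanSpace ℝ (Fin d)) (𝓡∂ d) (pt x₀) (range (𝓡∂ d)) y :=
  mdifferentiableWithinAt_extChartAt_symm hy

theorem contMDiffWithinAt_pt (hy : y ∈ (extChartAt (𝓡∂ d) x₀).target) :
    ContMDiffWithinAt 𝓘(ℝ, EuclideanSpace ℝ (Fin d)) (𝓡∂ d) ∞ (pt x₀) (range (𝓡∂ d)) y :=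
  contMDiffWithinAt_extChartAt_symm_range x₀ hy

theorem ContMDiffAt.smoothAt_comp_pt {f : M → ℝ} (hy : y ∈ (extChartAt (𝓡∂ d) x₀).target)
    (hf : ContMDiffAt (𝓡∂ d) 𝓘(ℝ, ℝ) ∞ f (pt x₀ y)) : SmoothAt (fun z ↦ f (pt x₀ z)) y :=
  (hf.comp_contMDiffWithinAt y (contMDiffWithinAt_pt hy)).contDiffWithinAt

/-- The components of the differential of a function. -/
theorem differential_coordVec {f : M → ℝ} (hy : y ∈ (extChartAt (𝓡∂ d) x₀).target)
    (hf : MDifferentiableAt (𝓡∂ d) 𝓘(ℝ, ℝ) f (pt x₀ y)) (i : Fin d) :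
    differential f (pt x₀ y) (coordVec x₀ y i) = pderiv i (fun z ↦ f (pt x₀ z)) y := by
  have h := mfderiv_comp_mfderivWithin y hf (mdifferentiableWithinAt_pt hy)
    ((𝓡∂ d).uniqueMDiffOn _ (mem_range_of_mem_target hy))
  rw [mfderivWithin_eq_fderivWithin] at h
  have h2 := congrArg (fun L : EuclideanSpace ℝ (Fin d) →L[ℝ] ℝ ↦ L (EuclideanSpace.single i 1)) h
  exact h2.symm

/-- The coordinate vector fields form a basis. -/
theorem exists_frame (hy : y ∈ (extChartAt (𝓡∂ d) x₀).target) :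
    ∃ A : EuclideanSpace ℝ (Fin d) ≃L[ℝ] EuclideanSpace ℝ (Fin d),
      ∀ i, coordVec x₀ y i = A (EuclideanSpace.single i (1 : ℝ)) := by
  obtain ⟨A, hA⟩ := isInvertible_mfderivWithin_extChartAt_symm (I := 𝓡∂ d) hy
  refine ⟨A, fun i ↦ ?_⟩
  exact (congrArg (fun L : EuclideanSpace ℝ (Fin d) →L[ℝ] EuclideanSpace ℝ (Fin d) ↦
    L (EuclideanSpace.single i (1 : ℝ))) hA).symm

theorem exists_coordVec_sum (hy : y ∈ (extChartAt (𝓡∂ d) x₀).target)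
    (v : TangentSpace (𝓡∂ d) (pt x₀ y)) : ∃ c : Fin d → ℝ, v = ∑ i, c i • coordVec x₀ y i := by
  obtain ⟨A, hA⟩ := exists_frame hy
  let w : EuclideanSpace ℝ (Fin d) := A.symm v
  have hsum : ∑ i, w i • EuclideanSpace.single i (1 : ℝ) = w := by
    simpa using (EuclideanSpace.basisFun (Fin d) ℝ).sum_repr w
  refine ⟨fun i ↦ w i, ?_⟩
  simp only [hA]
  have e := congrArg A hsum
  rw [map_sum] at e
  simp only [map_smul] at e
  exact (e.trans (A.apply_symm_apply v)).symm

theorem coordVec_linearIndependent (hy : y ∈ (extChartAt (𝓡∂ d) x₀).target) {c : Fin d → ℝ}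
    (hc : ∑ i, c i • coordVec x₀ y i = 0) : c = 0 := by
  obtain ⟨A, hA⟩ := exists_frame hy
  simp only [hA] at hc
  have h1 : A (∑ i, c i • EuclideanSpace.single i (1 : ℝ)) = 0 := by
    rw [map_sum]
    simp only [map_smul]
    exact hc
  have h2 := A.map_eq_zero_iff.1 h1
  funext j
  have h3 := congrArg (fun v : EuclideanSpace ℝ (Fin d) ↦ v j) h2
  simpa [Finset.sum_apply, Pi.single_apply] using h3

theorem covector_ext (hy : y ∈ (extChartAt (𝓡∂ d) x₀).target)
    {μ ν : TangentSpace (𝓡∂ d) (pt x₀ y) →L[ℝ] ℝ}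
    (h : ∀ i, μ (coordVec x₀ y i) = ν (coordVec x₀ y i)) : μ = ν := by
  ext v
  obtain ⟨c, rfl⟩ := exists_coordVec_sum hy v
  rw [map_sum, map_sum]
  exact Finset.sum_congr rfl fun i _ ↦ by rw [map_smul, map_smul, h]

/-- The coordinate field is the tangent map of the inverse chart applied to a constant field.
Derivatives within the chart target and within the half space agree on the target. -/
theorem contMDiffWithinAt_coordVec (hy : y ∈ (extChartAt (𝓡∂ d) x₀).target) (i : Fin d) :
    ContMDiffWithinAt 𝓘(ℝ, EuclideanSpace ℝ (Fin d)) (𝓡∂ d).tangent ∞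
      (fun z ↦ (TotalSpace.mk' (EuclideanSpace ℝ (Fin d)) (pt x₀ z) (coordVec x₀ z i) :
        TangentBundle (𝓡∂ d) M)) (range (𝓡∂ d)) y := by
  have hu : UniqueMDiffOn 𝓘(ℝ, EuclideanSpace ℝ (Fin d)) (extChartAt (𝓡∂ d) x₀).target :=
    (uniqueDiffOn_extChartAt_target x₀).uniqueMDiffOn
  have h := (contMDiffOn_extChartAt_symm (I := 𝓡∂ d) (n := ∞) x₀).contMDiffOn_tangentMapWithin
    (m := ∞) (by simp) hu
  let e : EuclideanSpace ℝ (Fin d) := EuclideanSpace.single i (1 : ℝ)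
  have hs : ContMDiffWithinAt 𝓘(ℝ, EuclideanSpace ℝ (Fin d))
      𝓘(ℝ, EuclideanSpace ℝ (Fin d)).tangent ∞
      (fun z : EuclideanSpace ℝ (Fin d) ↦
        (⟨z, e⟩ : TangentBundle 𝓘(ℝ, EuclideanSpace ℝ (Fin d)) (EuclideanSpace ℝ (Fin d))))
      (extChartAt (𝓡∂ d) x₀).target y :=
    contMDiffWithinAt_vectorSpace_iff_contDiffWithinAt.2 contDiffWithinAt_const
  have h2 := ContMDiffWithinAt.comp y (f := fun z : EuclideanSpace ℝ (Fin d) ↦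
        (⟨z, e⟩ : TangentBundle 𝓘(ℝ, EuclideanSpace ℝ (Fin d)) (EuclideanSpace ℝ (Fin d))))
      (h ⟨y, e⟩ hy) hs (fun z hz ↦ hz)
  have heq : ∀ z ∈ (extChartAt (𝓡∂ d) x₀).target,
      (TotalSpace.mk' (EuclideanSpace ℝ (Fin d)) (pt x₀ z) (coordVec x₀ z i) :
        TangentBundle (𝓡∂ d) M) = tangentMapWithin 𝓘(ℝ, EuclideanSpace ℝ (Fin d)) (𝓡∂ d)
        (extChartAt (𝓡∂ d) x₀).symm (extChartAt (𝓡∂ d) x₀).target ⟨z, e⟩ := fun z hz ↦ by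
    have h3 := mfderivWithin_subset (extChartAt_target_subset_range x₀) (hu z hz)
      (mdifferentiableWithinAt_pt hz)
    exact congrArg (fun L : EuclideanSpace ℝ (Fin d) →L[ℝ] EuclideanSpace ℝ (Fin d) ↦
      (TotalSpace.mk' (EuclideanSpace ℝ (Fin d)) (pt x₀ z) (L e) : TangentBundle (𝓡∂ d) M)) h3.symm
  exact (h2.congr heq (heq y hy)).mono_of_mem_nhdsWithin
    (extChartAt_target_mem_nhdsWithin_of_mem hy)

/-- The inverse of a nondegenerate bilinear form in terms of a frame. -/
theorem apply_inverse_eq_sum {V : Type*} [NormedAddCommGroup V] [NormedSpace ℝ V] {ι : Type*}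
    [Fintype ι] {B : V →L[ℝ] V →L[ℝ] ℝ} {e : ι → V} {G G' : ι → ι → ℝ}
    (hB : ∀ v, v ≠ 0 → 0 < B v v) (he : ∀ i j, B (e i) (e j) = G i j)
    (hext : ∀ μ ν : V →L[ℝ] ℝ, (∀ i, μ (e i) = ν (e i)) → μ = ν)
    (hG : ∀ (a : ι → ℝ) (i : ι), ∑ k, G k i * ∑ l, G' k l * a l = a i) (μ ν : V →L[ℝ] ℝ) :
    μ (ContinuousLinearMap.inverse B ν) = ∑ i, ∑ j, G' i j * μ (e i) * ν (e j) := by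
  let W : (V →L[ℝ] ℝ) →L[ℝ] V :=
    ∑ i, ∑ j, G' i j • (ContinuousLinearMap.apply ℝ ℝ (e j)).smulRight (e i)
  have hW : ∀ ν, W ν = ∑ i, (∑ j, G' i j * ν (e j)) • e i := by
    intro ν
    simp [W, smul_smul, Finset.sum_smul]
  have h1 : B ∘L W = .id ℝ _ := by
    ext1 ν
    refine hext _ _ fun k ↦ ?_
    rw [ContinuousLinearMap.comp_apply, hW, map_sum]
    simp [he]
    rw [← hG (fun j ↦ ν (e j)) k]
    exact Finset.sum_congr rfl fun i _ ↦ mul_comm _ _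
  -- `ContinuousLinearMap.inverse` is zero by default on non-invertible maps, so `W` must be a
  -- two-sided inverse. Positivity makes `B` injective, which upgrades the right inverse.
  have hinj : ∀ v w, B v = B w → v = w := by
    intro v w e
    by_contra hne
    have hp := hB (v - w) (sub_ne_zero.2 hne)
    have : B (v - w) = 0 := by rw [map_sub, e, sub_self]
    rw [this] at hp
    simp at hp
  have h2 : W ∘L B = .id ℝ _ := by
    ext1 v
    refine hinj _ _ ?_
    exact congrArg (fun L ↦ L (B v)) h1
  rw [ContinuousLinearMap.inverse_eq h1 h2, hW, map_sum]
  refine Finset.sum_congr rfl fun i _ ↦ ?_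
  rw [map_smul, smul_eq_mul, Finset.sum_mul]
  exact Finset.sum_congr rfl fun j _ ↦ by ring

theorem IsRiemannianMetricOn.isCoordMetricOn {g : BilinField d M}
    (hg : IsRiemannianMetricOn g univ) (x₀ : M) :
    IsCoordMetricOn g x₀ (extChartAt (𝓡∂ d) x₀).target where
  subset := extChartAt_target_subset_range x₀
  mem_nhds y hy := extChartAt_target_mem_nhdsWithin_of_mem hy
  smooth y hy i j := by
    have hb : ContMDiffWithinAt 𝓘(ℝ, EuclideanSpace ℝ (Fin d))
        ((𝓡∂ d).prod 𝓘(ℝ, EuclideanSpace ℝ (Fin d) →L[ℝ] EuclideanSpace ℝ (Fin d) →L[ℝ] ℝ)) ∞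
        (fun z ↦ TotalSpace.mk'
          (EuclideanSpace ℝ (Fin d) →L[ℝ] EuclideanSpace ℝ (Fin d) →L[ℝ] ℝ)
          (E := fun x : M ↦ TangentSpace (𝓡∂ d) x →L[ℝ] TangentSpace (𝓡∂ d) x →L[ℝ]
            Bundle.Trivial M ℝ x) (pt x₀ z)
          (g (pt x₀ z))) (range (𝓡∂ d)) y :=
      (hg.smooth.contMDiffAt Filter.univ_mem).comp_contMDiffWithinAt y (contMDiffWithinAt_pt hy)
    have := ContMDiffWithinAt.clm_bundle_apply₂ (F₃ := ℝ) (E₃ := Bundle.Trivial M ℝ)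
      (ψ := fun z ↦ g (pt x₀ z)) hb (contMDiffWithinAt_coordVec hy i)
      (contMDiffWithinAt_coordVec hy j)
    rw [contMDiffWithinAt_totalSpace] at this
    exact this.2.contDiffWithinAt
  symm y hy i j := hg.symm _ (mem_univ _) _ _
  det_ne y hy hdet := by
    -- A kernel vector of the component matrix would be a nonzero tangent vector of length zero.
    obtain ⟨c, hc, h⟩ := Matrix.exists_mulVec_eq_zero_iff.2 hdet
    have hv : ∑ i, c i • coordVec x₀ y i ≠ 0 := fun h0 ↦ hc (coordVec_linearIndependent hy h0)
    have hp := hg.pos _ (mem_univ _) _ hv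
    have : g (pt x₀ y) (∑ i, c i • coordVec x₀ y i) (∑ i, c i • coordVec x₀ y i)
        = ∑ i, c i * (metricCoord g x₀ y).mulVec c i := by
      rw [hg.symm _ (mem_univ _), map_sum]
      refine Finset.sum_congr rfl fun i _ ↦ ?_
      rw [map_smul, hg.symm _ (mem_univ _), map_sum, smul_eq_mul]
      congr 1
      simp only [Matrix.mulVec, dotProduct, map_smul, smul_eq_mul]
      exact Finset.sum_congr rfl fun j _ ↦ mul_comm _ _
    rw [this, h] at hp
    simp at hp

theorem cometric_eq_sum {g : BilinField d M} (hg : IsRiemannianMetricOn g univ)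
    (hy : y ∈ (extChartAt (𝓡∂ d) x₀).target) (μ ν : TangentSpace (𝓡∂ d) (pt x₀ y) →L[ℝ] ℝ) :
    cometric (g (pt x₀ y)) μ ν = ∑ i, ∑ j, invMetricCoord g x₀ y i j * μ (coordVec x₀ y i)
      * ν (coordVec x₀ y j) := by
  have h := hg.isCoordMetricOn x₀
  refine apply_inverse_eq_sum (V := EuclideanSpace ℝ (Fin d)) (B := g (pt x₀ y))
    (e := coordVec x₀ y) (G := fun i j ↦ metricCoord g x₀ y i j)
    (G' := fun i j ↦ invMetricCoord g x₀ y i j) (hg.pos _ (mem_univ _)) (fun i j ↦ rfl)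
    (fun μ ν ↦ covector_ext hy) (fun a i ↦ ?_) μ ν
  rw [← h.lower_raise hy a i]
  exact Finset.sum_congr rfl fun k _ ↦ by rw [h.symm y hy k i]

/-- The differential of a smooth function is a smooth covector field. -/
theorem contMDiff_differential {f : M → ℝ} (hf : ContMDiff (𝓡∂ d) 𝓘(ℝ, ℝ) ∞ f) :
    ContMDiff (𝓡∂ d) ((𝓡∂ d).prod 𝓘(ℝ, EuclideanSpace ℝ (Fin d) →L[ℝ] ℝ)) ∞
    fun x ↦ TotalSpace.mk' (EuclideanSpace ℝ (Fin d) →L[ℝ] ℝ)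
      (E := fun x : M ↦ TangentSpace (𝓡∂ d) x →L[ℝ] Bundle.Trivial M ℝ x) x
      (differential (d := d) f x) := by
  intro x
  rw [contMDiffAt_hom_bundle]
  refine ⟨contMDiffAt_id, ?_⟩
  have := (hf x).mfderiv_const (m := ∞) (by simp)
  convert! this using 1
  ext x' v
  simp [inTangentCoordinates, ContinuousLinearMap.inCoordinates]
  rfl

end Charts

/-! ### Dictionary between invariant and coordinate expressions. -/

section Bridge

variable {d : ℕ} [NeZero d]
  {M : Type*} [TopologicalSpace M] [ChartedSpace (EuclideanHalfSpace d) M]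
  [IsManifold (𝓡∂ d) ∞ M] {x₀ : M} {y : EuclideanSpace ℝ (Fin d)} {g : BilinField d M}
  {s u : M → ℝ}

omit [IsManifold (𝓡∂ d) ∞ M] in
theorem pt_extChartAt (x : M) : pt x (extChartAt (𝓡∂ d) x x) = x := extChartAt_to_inv x

theorem smoothAt_comp_pt (hs : ContMDiff (𝓡∂ d) 𝓘(ℝ, ℝ) ∞ s)
    (hy : y ∈ (extChartAt (𝓡∂ d) x₀).target) : SmoothAt (fun z ↦ s (pt x₀ z)) y :=
  ContMDiffAt.smoothAt_comp_pt hy (hs _)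

theorem covectorCoord_differential (hs : ContMDiff (𝓡∂ d) 𝓘(ℝ, ℝ) ∞ s)
    (hy : y ∈ (extChartAt (𝓡∂ d) x₀).target) (i : Fin d) :
    covectorCoord x₀ (differential s) i y = pderiv i (fun z ↦ s (pt x₀ z)) y :=
  differential_coordVec hy ((hs _).mdifferentiableAt (by simp)) i

omit [IsManifold (𝓡∂ d) ∞ M] in
-- Stated for covectors whose components are partial derivatives, so as to cover both `ds` and the
-- middle slot of a parallel tractor.
theorem covDeriv_eq_hessian {μ : CovectorField d M}
    (hμ : ∀ z ∈ (extChartAt (𝓡∂ d) x₀).target, ∀ i,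
      covectorCoord x₀ μ i z = pderiv i (fun z ↦ s (pt x₀ z)) z)
    (hy : y ∈ (extChartAt (𝓡∂ d) x₀).target) (i j : Fin d) :
    covDeriv g x₀ μ i j y = hessian g x₀ (fun z ↦ s (pt x₀ z)) i j y := by
  have h : covectorCoord x₀ μ j =ᶠ[𝓝[range (𝓡∂ d)] y] pderiv j (fun z ↦ s (pt x₀ z)) := by
    filter_upwards [extChartAt_target_mem_nhdsWithin_of_mem hy] with z hz using hμ z hz j
  rw [covDeriv, hessian, pderiv_congr (mem_range_of_mem_target hy) h]
  congr 1
  exact Finset.sum_congr rfl fun k _ ↦ by rw [hμ y hy]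

theorem laplacian_eq_traceHessian (hs : ContMDiff (𝓡∂ d) 𝓘(ℝ, ℝ) ∞ s)
    (hy : y ∈ (extChartAt (𝓡∂ d) x₀).target) :
    laplacian g x₀ s y = -traceHessian g x₀ (fun z ↦ s (pt x₀ z)) y := by
  simp only [laplacian, traceHessian,
    covDeriv_eq_hessian (fun z hz i ↦ covectorCoord_differential hs hz i) hy]

theorem cometric_differential (hg : IsRiemannianMetricOn g univ)
    (hs : ContMDiff (𝓡∂ d) 𝓘(ℝ, ℝ) ∞ s) (hu : ContMDiff (𝓡∂ d) 𝓘(ℝ, ℝ) ∞ u)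
    (hy : y ∈ (extChartAt (𝓡∂ d) x₀).target) :
    cometric (g (pt x₀ y)) (differential s (pt x₀ y)) (differential u (pt x₀ y))
      = ∑ i, ∑ j, invMetricCoord g x₀ y i j * pderiv i (fun z ↦ s (pt x₀ z)) y
        * pderiv j (fun z ↦ u (pt x₀ z)) y := by
  rw [cometric_eq_sum hg hy]
  refine Finset.sum_congr rfl fun i _ ↦ Finset.sum_congr rfl fun j _ ↦ ?_
  rw [← covectorCoord_differential hs hy, ← covectorCoord_differential hu hy]
  rfl

theorem cometric_differential_self (hg : IsRiemannianMetricOn g univ)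
    (hs : ContMDiff (𝓡∂ d) 𝓘(ℝ, ℝ) ∞ s) (hy : y ∈ (extChartAt (𝓡∂ d) x₀).target) :
    cometric (g (pt x₀ y)) (differential s (pt x₀ y)) (differential s (pt x₀ y))
      = gradSq g x₀ (fun z ↦ s (pt x₀ z)) y :=
  cometric_differential hg hs hs hy

theorem smoothAt_cometric (hg : IsRiemannianMetricOn g univ)
    (hs : ContMDiff (𝓡∂ d) 𝓘(ℝ, ℝ) ∞ s) (hu : ContMDiff (𝓡∂ d) 𝓘(ℝ, ℝ) ∞ u)
    (hy : y ∈ (extChartAt (𝓡∂ d) x₀).target) :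
    SmoothAt (fun z ↦ cometric (g (pt x₀ z)) (differential s (pt x₀ z))
      (differential u (pt x₀ z))) y := by
  have hy' := mem_range_of_mem_target hy
  have h : SmoothAt (fun z ↦ ∑ i, ∑ j, invMetricCoord g x₀ z i j
      * pderiv i (fun z ↦ s (pt x₀ z)) z * pderiv j (fun z ↦ u (pt x₀ z)) z) y :=
    ContDiffWithinAt.sum fun i _ ↦ ContDiffWithinAt.sum fun j _ ↦
      (((hg.isCoordMetricOn x₀).smooth_inv hy i j).mul
        ((smoothAt_comp_pt hs hy).pderiv hy' i)).mul ((smoothAt_comp_pt hu hy).pderiv hy' j)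
  refine ContDiffWithinAt.congr_of_eventuallyEq h ?_ (cometric_differential hg hs hu hy)
  filter_upwards [extChartAt_target_mem_nhdsWithin_of_mem hy] with z hz
    using cometric_differential hg hs hu hz

theorem cometric_symm (hg : IsRiemannianMetricOn g univ) (x : M)
    (μ ν : TangentSpace (𝓡∂ d) x →L[ℝ] ℝ) : cometric (g x) μ ν = cometric (g x) ν μ := by
  have hy := mem_extChartAt_target (I := 𝓡∂ d) x
  -- The point `pt x (extChartAt _ x x)` equals `x` only propositionally. Quantifying over the
  -- covectors first allows the base point to be rewritten.
  have key : ∀ μ ν : TangentSpace (𝓡∂ d) (pt x (extChartAt (𝓡∂ d) x x)) →L[ℝ] ℝ,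
      cometric (g (pt x (extChartAt (𝓡∂ d) x x))) μ ν
        = cometric (g (pt x (extChartAt (𝓡∂ d) x x))) ν μ := by
    intro μ ν
    rw [cometric_eq_sum hg hy, cometric_eq_sum hg hy, Finset.sum_comm]
    refine Finset.sum_congr rfl fun i _ ↦ Finset.sum_congr rfl fun j _ ↦ ?_
    rw [(hg.isCoordMetricOn x).inv_symm hy i j]
    ring
  rw [pt_extChartAt] at key
  exact key μ ν

theorem cometric_rescale (hg : IsRiemannianMetricOn g univ)
    (hu : ContMDiff (𝓡∂ d) 𝓘(ℝ, ℝ) ∞ u) (x : M) (μ ν : TangentSpace (𝓡∂ d) x →L[ℝ] ℝ) :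
    cometric (rescale u g x) μ ν = Real.exp (-u x) ^ 2 * cometric (g x) μ ν := by
  have hy := mem_extChartAt_target (I := 𝓡∂ d) x
  set y := extChartAt (𝓡∂ d) x x with hyd
  have hinv : invMetricCoord (rescale u g) x y
      = (Real.exp (-u (pt x y)) ^ 2) • invMetricCoord g x y := by
    refine Matrix.inv_eq_left_inv ?_
    have : metricCoord (rescale u g) x y = Real.exp (2 * u (pt x y)) • metricCoord g x y := rfl
    rw [this, Matrix.smul_mul, Matrix.mul_smul, smul_smul, (hg.isCoordMetricOn x).inv_mul hy,
      ← Real.exp_nat_mul, ← Real.exp_add]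
    simp
  have key : ∀ μ ν : TangentSpace (𝓡∂ d) (pt x y) →L[ℝ] ℝ,
      cometric (rescale u g (pt x y)) μ ν
        = Real.exp (-u (pt x y)) ^ 2 * cometric (g (pt x y)) μ ν := by
    intro μ ν
    rw [cometric_eq_sum (hg.rescale hu) hy, cometric_eq_sum hg hy, hinv, Finset.mul_sum]
    refine Finset.sum_congr rfl fun i _ ↦ ?_
    rw [Finset.mul_sum]
    refine Finset.sum_congr rfl fun j _ ↦ ?_
    rw [Matrix.smul_apply, smul_eq_mul]
    ring
  rw [hyd, pt_extChartAt] at key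
  exact key μ ν

omit [IsManifold (𝓡∂ d) ∞ M] in
-- This Leibniz rule is the middle slot of `changeSplitting`.
theorem differential_exp_mul (hs : ContMDiff (𝓡∂ d) 𝓘(ℝ, ℝ) ∞ s)
    (hu : ContMDiff (𝓡∂ d) 𝓘(ℝ, ℝ) ∞ u) (x : M) :
    differential (d := d) (fun x ↦ Real.exp (u x) * s x) x
      = Real.exp (u x) • (differential s x + s x • differential u x) := by
  have h1 := ((hs x).mdifferentiableAt (by simp)).hasMFDerivAt
  have h2 := ((hu x).mdifferentiableAt (by simp)).hasMFDerivAt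
  have h3 : HasMFDerivAt 𝓘(ℝ, ℝ) 𝓘(ℝ, ℝ) Real.exp (u x)
      (ContinuousLinearMap.smulRight (1 : ℝ →L[ℝ] ℝ) (Real.exp (u x))) :=
    (Real.hasDerivAt_exp (u x)).hasFDerivAt.hasMFDerivAt
  have h4 := (h3.comp x h2).mul h1
  refine h4.mfderiv.trans ?_
  ext v
  have e : ∀ a b : ℝ, Real.exp (u x) * a + s x * (b * Real.exp (u x))
      = Real.exp (u x) * (a + s x * b) := fun a b ↦ by ring
  exact e (differential s x v) (differential u x v)

omit [IsManifold (𝓡∂ d) ∞ M] in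
theorem IsCoordMetricOn.mono {U V : Set (EuclideanSpace ℝ (Fin d))} (h : IsCoordMetricOn g x₀ U)
    (hVU : V ⊆ U) (hV : ∀ y ∈ V, V ∈ 𝓝[range (𝓡∂ d)] y) : IsCoordMetricOn g x₀ V where
  subset := hVU.trans h.subset
  mem_nhds := hV
  smooth y hy := h.smooth y (hVU hy)
  symm y hy := h.symm y (hVU hy)
  det_ne y hy := h.det_ne y (hVU hy)

/-- The formulas for `f⁻² g` require a relatively open set on which `f` does not vanish. -/
theorem isCoordMetricOn_ne_zero (hg : IsRiemannianMetricOn g univ)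
    (hs : ContMDiff (𝓡∂ d) 𝓘(ℝ, ℝ) ∞ s) (x₀ : M) :
    IsCoordMetricOn g x₀ {z | z ∈ (extChartAt (𝓡∂ d) x₀).target ∧ s (pt x₀ z) ≠ 0} :=
  (hg.isCoordMetricOn x₀).mono (fun _ hz ↦ hz.1) fun _ hz ↦
    Filter.inter_mem (extChartAt_target_mem_nhdsWithin_of_mem hz.1)
      ((smoothAt_comp_pt hs hz.1).continuousWithinAt.eventually_ne hz.2)

end Bridge

/-! ### From a parallel tractor to a Poincaré–Einstein metric. -/

section ScaleToMetric

variable {d : ℕ} [NeZero d]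
  {M : Type*} [TopologicalSpace M] [ChartedSpace (EuclideanHalfSpace d) M]
  [IsManifold (𝓡∂ d) ∞ M]

/-- A function which vanishes precisely on the boundary locally does not change sign. -/
theorem eventually_nonneg_or_nonpos {s : M → ℝ} (hs : ContMDiff (𝓡∂ d) 𝓘(ℝ, ℝ) ∞ s)
    (h0 : ∀ x, s x = 0 → x ∈ (𝓡∂ d).boundary M) (x : M) :
    (∀ᶠ q in 𝓝 x, 0 ≤ s q) ∨ (∀ᶠ q in 𝓝 x, s q ≤ 0) := by
  obtain ⟨r, hr, hball⟩ := Metric.mem_nhdsWithin_iff.1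
    (extChartAt_target_mem_nhdsWithin (I := 𝓡∂ d) x)
  set p := extChartAt (𝓡∂ d) x x
  -- The open part of a half ball is convex and consists of interior points, so `s` has no zero on
  -- it. By the intermediate value theorem it has one sign there, which extends to the closure by
  -- continuity.
  set S := Metric.ball p r ∩ interior (range (𝓡∂ d)) with hS
  have hsub : S ⊆ (extChartAt (𝓡∂ d) x).target := fun z hz ↦
    hball ⟨hz.1, interior_subset hz.2⟩
  have hne : ∀ z ∈ S, s (pt x z) ≠ 0 := fun z hz hsz ↦ by
    have hb := h0 _ hsz
    have hsrc : pt x z ∈ (chartAt (EuclideanHalfSpace d) x).source := by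
      rw [← extChartAt_source (𝓡∂ d)]
      exact (extChartAt (𝓡∂ d) x).map_target (hsub hz)
    have hint : (𝓡∂ d).IsInteriorPoint (pt x z) := by
      rw [(𝓡∂ d).isInteriorPoint_iff_of_mem_atlas (n := ∞) (by simp)
        (chart_mem_atlas (EuclideanHalfSpace d) x) hsrc]
      have e : ((chartAt (EuclideanHalfSpace d) x).extend (𝓡∂ d)) (pt x z) = z :=
        (extChartAt (𝓡∂ d) x).right_inv (hsub hz)
      rw [e]
      exact interior_maximal hsub (Metric.isOpen_ball.inter isOpen_interior) hz
    exact ((𝓡∂ d).isInteriorPoint_iff_not_isBoundaryPoint _).1 hint hb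
  have hconv : Convex ℝ S := (convex_ball p r).inter (𝓡∂ d).convex_range.interior
  have hcont : ContinuousOn (fun z ↦ s (pt x z)) S := fun z hz ↦
    (smoothAt_comp_pt hs (hsub hz)).continuousWithinAt.mono
      (inter_subset_right.trans interior_subset)
  -- The factor `t = ±1` treats both signs at once.
  have hext : ∀ t : ℝ, (∀ z ∈ S, 0 ≤ t * s (pt x z)) → ∀ᶠ q in 𝓝 x, 0 ≤ t * s q := by
    intro t ht
    have hclos : ∀ z ∈ Metric.ball p r ∩ range (𝓡∂ d), 0 ≤ t * s (pt x z) := by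
      intro z hz
      have hzS : z ∈ closure S := by
        have : z ∈ closure (interior (range (𝓡∂ d))) :=
          (𝓡∂ d).range_subset_closure_interior hz.2
        exact Metric.isOpen_ball.inter_closure ⟨hz.1, this⟩
      have : (𝓝[S] z).NeBot := mem_closure_iff_nhdsWithin_neBot.1 hzS
      have hc : Filter.Tendsto (fun z ↦ t * s (pt x z)) (𝓝[S] z) (𝓝 (t * s (pt x z))) :=
        (continuousWithinAt_const.mul ((smoothAt_comp_pt hs
          (hball hz)).continuousWithinAt.mono (inter_subset_right.trans interior_subset)))
      exact ge_of_tendsto hc (Filter.eventually_of_mem self_mem_nhdsWithin ht)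
    have hb : ∀ᶠ q in 𝓝 x, extChartAt (𝓡∂ d) x q ∈ Metric.ball p r :=
      (continuousAt_extChartAt x).eventually (Metric.ball_mem_nhds p hr)
    filter_upwards [hb, extChartAt_source_mem_nhds (I := 𝓡∂ d) x] with q hq hq'
    have := hclos _ ⟨hq, mem_range_of_mem_target ((extChartAt (𝓡∂ d) x).map_source hq')⟩
    rwa [pt, (extChartAt (𝓡∂ d) x).left_inv hq'] at this
  by_cases hpos : ∀ z ∈ S, 0 ≤ s (pt x z)
  · left
    simpa using hext 1 (by simpa using hpos)
  · right
    push Not at hpos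
    obtain ⟨a, ha, hsa⟩ := hpos
    have := hext (-1) fun z hz ↦ by
      by_contra hcon
      have hsz : 0 < s (pt x z) := by linarith
      obtain ⟨w, hw, hw0⟩ := hconv.isPreconnected.intermediate_value ha hz hcont
        ⟨hsa.le, hsz.le⟩
      exact hne w hw hw0
    filter_upwards [this] with q hq
    linarith

namespace Tractor

variable {c : ConformalStructure d M} (T : Tractor c)

theorem scale_eq (g : c.metrics) (x : M) : T.scale g x = (T.val g x).σ := by
  simp [scale, tractorMetric, canonicalX, cometric]

theorem contMDiff_scale (g : c.metrics) : ContMDiff (𝓡∂ d) 𝓘(ℝ, ℝ) ∞ (T.scale g) := by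
  rw [funext (T.scale_eq g)]
  exact T.smooth_σ g

theorem mem_singularSet_iff (g : c.metrics) (x : M) : x ∈ T.singularSet ↔ T.scale g x = 0 := by
  refine ⟨fun h ↦ h g, fun h g' ↦ ?_⟩
  obtain ⟨u, hu, e⟩ := c.conformal g g.2 g' g'.2
  rw [scale_eq] at h ⊢
  rw [T.val_rescale g g' u hu e x]
  simp [changeSplitting, h]

variable {T}

theorem IsParallel.covectorCoord (hT : T.IsParallel) (g : c.metrics) {x₀ : M}
    {y : EuclideanSpace ℝ (Fin d)} (hy : y ∈ (extChartAt (𝓡∂ d) x₀).target) (i : Fin d) :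
    covectorCoord x₀ (fun x ↦ (T.val g x).μ) i y = pderiv i (fun z ↦ T.scale g (pt x₀ z)) y := by
  have h := congrArg Prod.fst (hT g x₀ y hy i)
  simp only [T.scale_eq g]
  exact (sub_eq_zero.1 h).symm

/-- The vanishing top slot of the connection identifies `μ` with `dσ`. -/
theorem IsParallel.differential_scale (hT : T.IsParallel) (g : c.metrics) (x : M) :
    differential (T.scale g) x = (T.val g x).μ := by
  have hy := mem_extChartAt_target (I := 𝓡∂ d) x
  have key : differential (T.scale g) (pt x (extChartAt (𝓡∂ d) x x))
      = (T.val g (pt x (extChartAt (𝓡∂ d) x x))).μ := by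
    refine covector_ext hy fun i ↦ ?_
    exact (covectorCoord_differential (T.contMDiff_scale g) hy i).trans
      (hT.covectorCoord g hy i).symm
  rwa [pt_extChartAt] at key

/-- A parallel tractor of length one whose scale vanishes precisely on the boundary gives a
conformal compactification. -/
theorem IsParallel.isConformalCompactification (hT : T.IsParallel)
    (hN : ∀ g x, T.normSq g x = 1) (hS : T.singularSet = (𝓡∂ d).boundary M) (g : c.metrics) :
    IsConformalCompactification (T.scaleMetric g) (fun x ↦ |T.scale g x|) g := by
  have hg := c.isMetric g g.2
  have hs := T.contMDiff_scale g
  have hzero : ∀ x, T.scale g x = 0 ↔ x ∈ (𝓡∂ d).boundary M := fun x ↦ by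
    rw [← T.mem_singularSet_iff g, hS]
  have hne : ∀ x ∈ (𝓡∂ d).interior M, T.scale g x ≠ 0 := fun x hx h ↦ by
    have := (hzero x).1 h
    rw [← (𝓡∂ d).compl_interior] at this
    exact this hx
  have hsign := eventually_nonneg_or_nonpos hs (fun x hx ↦ (hzero x).1 hx)
  -- Near each point `|σ|` is `σ` or `-σ`. Hence it is smooth, and its differential is `±dσ`.
  have habs : ∀ x, (fun x ↦ |T.scale g x|) =ᶠ[𝓝 x] T.scale g ∨
      (fun x ↦ |T.scale g x|) =ᶠ[𝓝 x] fun x ↦ -T.scale g x := fun x ↦ by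
    rcases hsign x with h | h
    · left; filter_upwards [h] with q hq using abs_of_nonneg hq
    · right; filter_upwards [h] with q hq using abs_of_nonpos hq
  refine ⟨⟨fun x _ v w ↦ ?_, fun x hx v hv ↦ ?_, ?_⟩, ⟨?_, fun x ↦ abs_nonneg _, fun x ↦ ?_, ?_⟩,
    hg, fun x hx ↦ ?_⟩
  · simp [scaleMetric, hg.symm x (mem_univ x) v w]
  · have h1 : 0 < (T.scale g x ^ 2)⁻¹ := by
      have := hne x hx
      positivity
    exact mul_pos h1 (hg.pos x (mem_univ x) v hv)
  · have h : ContMDiffOn (𝓡∂ d) 𝓘(ℝ, ℝ) ∞ (fun x ↦ (T.scale g x ^ 2)⁻¹)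
        ((𝓡∂ d).interior M) := fun x hx ↦
      ((hs.pow 2) x).contMDiffWithinAt.inv₀ (pow_ne_zero 2 (hne x hx))
    exact h.smul_section (hg.smooth.mono (subset_univ _))
  · intro x
    rcases habs x with h | h
    · exact (hs x).congr_of_eventuallyEq h
    · exact (hs x).neg.congr_of_eventuallyEq h
  · rw [abs_eq_zero, hzero]
  -- On the boundary `σ = 0`, so `|T|² = |dσ|²`. A vanishing differential would contradict length
  -- one.
  · intro x hx hd
    have h1 : differential (d := d) (T.scale g) x = 0 := by
      rcases habs x with h | h
      · rw [← hd]
        exact h.mfderiv_eq.symm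
      · have e : differential (d := d) (fun x ↦ |T.scale g x|) x
            = -differential (T.scale g) x :=
          h.mfderiv_eq.trans mfderiv_neg
        rw [hd] at e
        exact neg_eq_zero.1 e.symm
    rw [hT.differential_scale g] at h1
    have h2 := hN g x
    rw [normSq, tractorMetric, h1, ← T.scale_eq, (hzero x).2 hx] at h2
    simp [cometric] at h2
  · rw [scaleMetric, smul_smul, sq_abs, mul_inv_cancel₀ (pow_ne_zero 2 (hne x hx)), one_smul]

/-- The middle slot is the almost Einstein equation in coordinates, and `|T|² = 1` fixes the
Einstein constant. -/
theorem IsParallel.isNormalisedEinstein (hd : 3 ≤ d) (hT : T.IsParallel)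
    (hN : ∀ g x, T.normSq g x = 1) (hS : T.singularSet = (𝓡∂ d).boundary M) (g : c.metrics) :
    IsNormalisedEinstein (T.scaleMetric g) := by
  intro x₀ y hy hint i j
  have hg := c.isMetric g g.2
  have hs := T.contMDiff_scale g
  have h0 : T.scale g (pt x₀ y) ≠ 0 := fun h ↦ by
    rw [← T.mem_singularSet_iff g, hS, ← (𝓡∂ d).compl_interior] at h
    exact h hint
  refine (isCoordMetricOn_ne_zero hg hs x₀).einstein_of_almostEinstein hd
    (f := fun z ↦ T.scale g (pt x₀ z)) (ρ := (T.val g (pt x₀ y)).ρ)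
    (fun z hz ↦ smoothAt_comp_pt hs hz.1) (fun z hz ↦ hz.2) (fun z _ ↦ rfl) ⟨hy, h0⟩
    (fun i j ↦ ?_) ?_ i j
  · have h := congrFun (congrArg (fun t ↦ t.2.1) (hT g x₀ y hy i)) j
    rw [← covDeriv_eq_hessian (fun z hz i ↦ hT.covectorCoord g hz i) hy, T.scale_eq]
    exact h
  · have h := hN g (pt x₀ y)
    rw [normSq, tractorMetric, ← hT.differential_scale, cometric_differential_self hg hs hy,
      ← T.scale_eq] at h
    linarith

end Tractor

end ScaleToMetric

/-! ### From a Poincaré–Einstein metric to a parallel tractor. -/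

section MetricToScale

variable {d : ℕ} [NeZero d]
  {M : Type*} [TopologicalSpace M] [ChartedSpace (EuclideanHalfSpace d) M]

/-- The bottom component `-(J s + g^ij ∇_i ∇_j s) / d` of the tractor with scale `s`, in the
chart at `x₀`. -/
noncomputable def rhoCoord (g : BilinField d M) (s : M → ℝ) (x₀ : M)
    (y : EuclideanSpace ℝ (Fin d)) : ℝ :=
  -(1 / (d : ℝ)) * (schoutenTrace g x₀ y * s (pt x₀ y)
    + traceHessian g x₀ (fun z ↦ s (pt x₀ z)) y)

/-- The representation, in the splitting of `g`, of the tractor with scale `s`. -/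
noncomputable def scaleTractor (g : BilinField d M) (s : M → ℝ) (x : M) : SplitTractor d x where
  σ := s x
  μ := differential s x
  -- The value is read in the preferred chart at `x`; `rho_eq` shows that any other chart gives the
  -- same one in the Poincaré–Einstein case.
  ρ := rhoCoord g s x (extChartAt (𝓡∂ d) x x)

variable [IsManifold (𝓡∂ d) ∞ M] {x₀ : M} {y : EuclideanSpace ℝ (Fin d)}
  {g g₀ : BilinField d M} {s u : M → ℝ}

theorem smoothAt_rhoCoord (hg : IsRiemannianMetricOn g univ)
    (hs : ContMDiff (𝓡∂ d) 𝓘(ℝ, ℝ) ∞ s) (hy : y ∈ (extChartAt (𝓡∂ d) x₀).target) :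
    SmoothAt (rhoCoord g s x₀) y :=
  contDiffWithinAt_const.mul ((((hg.isCoordMetricOn x₀).smooth_schoutenTrace hy).mul
    (smoothAt_comp_pt hs hy)).add
      ((hg.isCoordMetricOn x₀).smooth_traceHessian hy (smoothAt_comp_pt hs hy)))

/-- The zero set of a defining function has empty interior. -/
theorem IsDefiningFunction.frequently_ne_zero (h : IsDefiningFunction d s)
    (hy : y ∈ (extChartAt (𝓡∂ d) x₀).target) :
    ∃ᶠ z in 𝓝[range (𝓡∂ d)] y, s (pt x₀ z) ≠ 0 := by
  intro hcon
  simp only [not_not] at hcon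
  have hy' := mem_range_of_mem_target hy
  have h0 : s (pt x₀ y) = 0 := hcon.self_of_nhdsWithin hy'
  -- If `s` vanished near `y`, then `y` would represent a boundary point at which `ds = 0`.
  refine h.differential_ne_zero _ ((h.zero_iff _).1 h0) (covector_ext hy fun i ↦ ?_)
  have e := covectorCoord_differential h.smooth hy i
  rw [pderiv_congr hy' hcon, pderiv_const] at e
  exact e

/-- Identities between continuous functions only have to be checked off the boundary. -/
theorem IsDefiningFunction.eq_of_forall_ne_zero (h : IsDefiningFunction d s)
    (hy : y ∈ (extChartAt (𝓡∂ d) x₀).target) {A B : EuclideanSpace ℝ (Fin d) → ℝ}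
    (hA : ContinuousWithinAt A (range (𝓡∂ d)) y) (hB : ContinuousWithinAt B (range (𝓡∂ d)) y)
    (hAB : ∀ᶠ z in 𝓝[range (𝓡∂ d)] y, s (pt x₀ z) ≠ 0 → A z = B z) : A y = B y := by
  by_contra hne
  have h1 : ∀ᶠ z in 𝓝[range (𝓡∂ d)] y, A z - B z ≠ 0 :=
    (hA.sub hB).eventually_ne (sub_ne_zero.2 hne)
  obtain ⟨z, hz, hz1, hz2⟩ := ((h.frequently_ne_zero hy).and_eventually (h1.and hAB)).exists
  exact hz1 (sub_eq_zero.2 (hz2 hz))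

namespace IsConformalCompactification

variable (h : IsConformalCompactification g₀ s g) (hE : IsNormalisedEinstein g₀) (hd : 3 ≤ d)
include h

theorem mem_interior {x : M} (hx : s x ≠ 0) : x ∈ (𝓡∂ d).interior M := by
  rw [← (𝓡∂ d).compl_boundary]
  exact fun hb ↦ hx ((h.defining.zero_iff x).2 hb)

theorem ne_zero {x : M} (hx : x ∈ (𝓡∂ d).interior M) : s x ≠ 0 := fun h0 ↦ by
  have := (h.defining.zero_iff x).1 h0
  rw [← (𝓡∂ d).compl_interior] at this
  exact this hx

theorem inv_smul_metric {x : M} (hx : x ∈ (𝓡∂ d).interior M) : (s x ^ 2)⁻¹ • g x = g₀ x := by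
  rw [h.extends_metric x hx, smul_smul, inv_mul_cancel₀ (pow_ne_zero 2 (h.ne_zero hx)), one_smul]

theorem metricCoord_eq (hy : s (pt x₀ y) ≠ 0) :
    metricCoord g₀ x₀ y = (s (pt x₀ y) ^ 2)⁻¹ • metricCoord g x₀ y := by
  ext i j
  rw [metricCoord, Matrix.of_apply, ← h.inv_smul_metric (h.mem_interior hy)]
  rfl

include hE hd

/-- The tractor of a conformal compactification of a Poincaré-Einstein metric has length one. -/
theorem gradSq_add (hy : y ∈ (extChartAt (𝓡∂ d) x₀).target) :
    gradSq g x₀ (fun z ↦ s (pt x₀ z)) y + 2 * (s (pt x₀ y) * rhoCoord g s x₀ y) = 1 := by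
  have hs := h.defining.smooth
  refine h.defining.eq_of_forall_ne_zero hy
    (A := fun y ↦ gradSq g x₀ (fun z ↦ s (pt x₀ z)) y + 2 * (s (pt x₀ y) * rhoCoord g s x₀ y))
    (B := fun _ ↦ 1) ?_ continuousWithinAt_const ?_
  · exact (((h.metric.isCoordMetricOn x₀).smooth_gradSq hy (smoothAt_comp_pt hs hy)).add
      (contDiffWithinAt_const.mul ((smoothAt_comp_pt hs hy).mul
        (smoothAt_rhoCoord h.metric hs hy)))).continuousWithinAt
  · filter_upwards [extChartAt_target_mem_nhdsWithin_of_mem hy] with z hz hz0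
    exact (isCoordMetricOn_ne_zero h.metric hs x₀).gradSq_of_einstein hd
      (fun z hz ↦ smoothAt_comp_pt hs hz.1) (fun z hz ↦ hz.2)
      (fun z hz ↦ h.metricCoord_eq hz.2) ⟨hz, hz0⟩ (hE x₀ z hz (h.mem_interior hz0))

/-- The scale of a conformal compactification of a Poincaré-Einstein metric solves the almost
Einstein equation. -/
theorem almostEinstein (hy : y ∈ (extChartAt (𝓡∂ d) x₀).target) (i j : Fin d) :
    hessian g x₀ (fun z ↦ s (pt x₀ z)) i j y + metricCoord g x₀ y i j * rhoCoord g s x₀ y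
      + schouten g x₀ i j y * s (pt x₀ y) = 0 := by
  have hs := h.defining.smooth
  have hG := h.metric.isCoordMetricOn x₀
  refine h.defining.eq_of_forall_ne_zero hy
    (A := fun y ↦ hessian g x₀ (fun z ↦ s (pt x₀ z)) i j y
      + metricCoord g x₀ y i j * rhoCoord g s x₀ y + schouten g x₀ i j y * s (pt x₀ y))
    (B := fun _ ↦ 0) ?_ continuousWithinAt_const ?_
  · exact (((hG.smooth_hessian hy (smoothAt_comp_pt hs hy) i j).add
      ((hG.smooth y hy i j).mul (smoothAt_rhoCoord h.metric hs hy))).add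
        ((hG.smooth_schouten hy i j).mul (smoothAt_comp_pt hs hy))).continuousWithinAt
  · filter_upwards [extChartAt_target_mem_nhdsWithin_of_mem hy] with z hz hz0
    exact (isCoordMetricOn_ne_zero h.metric hs x₀).almostEinstein_of_einstein hd
      (fun z hz ↦ smoothAt_comp_pt hs hz.1) (fun z hz ↦ hz.2)
      (fun z hz ↦ h.metricCoord_eq hz.2) ⟨hz, hz0⟩ (hE x₀ z hz (h.mem_interior hz0)) i j

/-- This is the bottom slot of the parallel equation: `pderiv_rho` gives it off the boundary, and
continuity does the rest. -/
theorem pderiv_rhoCoord (hy : y ∈ (extChartAt (𝓡∂ d) x₀).target) (i : Fin d) :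
    pderiv i (rhoCoord g s x₀) y - ∑ j, ∑ k, schouten g x₀ i j y * invMetricCoord g x₀ y j k
      * pderiv k (fun z ↦ s (pt x₀ z)) y = 0 := by
  have hs := h.defining.smooth
  have hG := h.metric.isCoordMetricOn x₀
  have hy' := mem_range_of_mem_target hy
  refine h.defining.eq_of_forall_ne_zero hy
    (A := fun y ↦ pderiv i (rhoCoord g s x₀) y - ∑ j, ∑ k, schouten g x₀ i j y
      * invMetricCoord g x₀ y j k * pderiv k (fun z ↦ s (pt x₀ z)) y)
    (B := fun _ ↦ 0) ?_ continuousWithinAt_const ?_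
  · exact (((smoothAt_rhoCoord h.metric hs hy).pderiv hy' i).sub
      (ContDiffWithinAt.sum fun j _ ↦ ContDiffWithinAt.sum fun k _ ↦
        ((hG.smooth_schouten hy i j).mul (hG.smooth_inv hy j k)).mul
          ((smoothAt_comp_pt hs hy).pderiv hy' k))).continuousWithinAt
  · filter_upwards [extChartAt_target_mem_nhdsWithin_of_mem hy] with z hz hz0
    exact (isCoordMetricOn_ne_zero h.metric hs x₀).pderiv_rho
      (fun z hz ↦ smoothAt_comp_pt hs hz.1) ⟨hz, hz0⟩ hz0 (smoothAt_rhoCoord h.metric hs hz)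
      (fun w hw ↦ h.gradSq_add hE hd hw.1) (fun i j ↦ h.almostEinstein hE hd hz i j) i

/-- The bottom component of the tractor does not depend on the chart. -/
theorem rho_eq (hy : y ∈ (extChartAt (𝓡∂ d) x₀).target) :
    (scaleTractor g s (pt x₀ y)).ρ = rhoCoord g s x₀ y := by
  have hs := h.defining.smooth
  set x := pt x₀ y with hx
  have hmem : ∀ᶠ z in 𝓝[range (𝓡∂ d)] y, pt x₀ z ∈ (extChartAt (𝓡∂ d) x).source :=
    (contMDiffWithinAt_pt hy).continuousWithinAt.eventually
      (extChartAt_source_mem_nhds (I := 𝓡∂ d) x)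
  have hxt : extChartAt (𝓡∂ d) x x ∈ (extChartAt (𝓡∂ d) x).target := mem_extChartAt_target x
  have hc1 : ContinuousWithinAt (fun z ↦ extChartAt (𝓡∂ d) x (pt x₀ z)) (range (𝓡∂ d)) y :=
    ContinuousAt.comp_continuousWithinAt (f := pt x₀) (g := extChartAt (𝓡∂ d) x)
      (continuousAt_extChartAt (I := 𝓡∂ d) x) (contMDiffWithinAt_pt hy).continuousWithinAt
  refine h.defining.eq_of_forall_ne_zero hy
    (A := fun z ↦ rhoCoord g s x (extChartAt (𝓡∂ d) x (pt x₀ z))) (B := rhoCoord g s x₀) ?_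
    (smoothAt_rhoCoord h.metric hs hy).continuousWithinAt ?_
  · refine ContinuousWithinAt.comp (g := rhoCoord g s x)
      (f := fun z ↦ extChartAt (𝓡∂ d) x (pt x₀ z)) (t := range (𝓡∂ d))
      (smoothAt_rhoCoord h.metric hs hxt).continuousWithinAt hc1 fun z _ ↦ ?_
    exact mem_range_self _
  · filter_upwards [extChartAt_target_mem_nhdsWithin_of_mem hy, hmem] with z hz hz1 hz0
    -- Where `s ≠ 0`, length one forces `ρ = (1 - |ds|²) / (2 s)` in both charts, and `|ds|²` is the
    -- chart-free `cometric`.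
    have e1 := h.gradSq_add hE hd hz
    have e2 := h.gradSq_add hE hd ((extChartAt (𝓡∂ d) x).map_source hz1)
    rw [← cometric_differential_self h.metric hs hz] at e1
    rw [← cometric_differential_self h.metric hs ((extChartAt (𝓡∂ d) x).map_source hz1)] at e2
    have e3 : pt x (extChartAt (𝓡∂ d) x (pt x₀ z)) = pt x₀ z :=
      (extChartAt (𝓡∂ d) x).left_inv hz1
    rw [e3] at e2
    exact mul_left_cancel₀ hz0 (by linarith)

theorem cometric_add (x : M) :
    cometric (g x) (differential s x) (differential s x)
      + 2 * (s x * (scaleTractor g s x).ρ) = 1 := by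
  have hy := mem_extChartAt_target (I := 𝓡∂ d) x
  have e := h.gradSq_add hE hd hy
  rw [← cometric_differential_self h.metric h.defining.smooth hy, pt_extChartAt] at e
  exact e

/-- The preferred chart varies with the point, but by `rho_eq` the chart at `x` computes `ρ` at all
nearby points. -/
theorem contMDiff_rho : ContMDiff (𝓡∂ d) 𝓘(ℝ, ℝ) ∞ fun x ↦ (scaleTractor g s x).ρ := by
  intro x
  have hs := h.defining.smooth
  have h1 : ContMDiffAt (𝓡∂ d) 𝓘(ℝ, ℝ) ∞
      (fun q ↦ rhoCoord g s x (extChartAt (𝓡∂ d) x q)) x := by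
    rw [← contMDiffWithinAt_univ]
    exact (smoothAt_rhoCoord h.metric hs (mem_extChartAt_target x)).contMDiffWithinAt.comp x
      (contMDiffAt_extChartAt (n := ∞)).contMDiffWithinAt fun z _ ↦ mem_range_self _
  refine h1.congr_of_eventuallyEq ?_
  filter_upwards [extChartAt_source_mem_nhds (I := 𝓡∂ d) x] with q hq
  have e := h.rho_eq hE hd ((extChartAt (𝓡∂ d) x).map_source hq)
  rw [pt, (extChartAt (𝓡∂ d) x).left_inv hq] at e
  exact e

/-- The tractor of a conformal compactification of a Poincaré-Einstein metric is parallel. -/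
theorem tractorConnection_eq_zero (hy : y ∈ (extChartAt (𝓡∂ d) x₀).target) (i : Fin d) :
    tractorConnection g (scaleTractor g s) x₀ y i = 0 := by
  have hs := h.defining.smooth
  have hρ : (fun z ↦ (scaleTractor g s (pt x₀ z)).ρ) =ᶠ[𝓝[range (𝓡∂ d)] y]
      rhoCoord g s x₀ := by
    filter_upwards [extChartAt_target_mem_nhdsWithin_of_mem hy] with z hz using h.rho_eq hE hd hz
  have hμ : ∀ z ∈ (extChartAt (𝓡∂ d) x₀).target, ∀ k,
      covectorCoord x₀ (fun x ↦ (scaleTractor g s x).μ) k z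
        = pderiv k (fun z ↦ s (pt x₀ z)) z := fun z hz k ↦ covectorCoord_differential hs hz k
  refine Prod.ext ?_ (Prod.ext ?_ ?_)
  · exact sub_eq_zero.2 (hμ y hy i).symm
  · funext j
    have e := h.almostEinstein hE hd hy i j
    rw [← covDeriv_eq_hessian hμ hy, ← h.rho_eq hE hd hy] at e
    exact e
  · have e := h.pderiv_rhoCoord hE hd hy i
    rw [← pderiv_congr (mem_range_of_mem_target hy) hρ] at e
    simp only [← hμ y hy] at e
    exact e

/-- By the choice of `ρ`, the term `(2 / d) s (J - Δ) s` equals `-2 s ρ`, so `S(s) = -(|ds|² + 2 s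
ρ)`. -/
theorem almostScalar_eq (hy : y ∈ (extChartAt (𝓡∂ d) x₀).target) :
    almostScalar g x₀ s y = -1 := by
  have hs := h.defining.smooth
  have e := h.gradSq_add hE hd hy
  have hd0 : (d : ℝ) ≠ 0 := by
    have : (3 : ℝ) ≤ d := by exact_mod_cast hd
    linarith
  rw [almostScalar, laplacian_eq_traceHessian hs hy, cometric_differential_self h.metric hs hy]
  rw [rhoCoord] at e
  field_simp at e ⊢
  linear_combination -e

omit hE hd in
theorem rescale (hu : ContMDiff (𝓡∂ d) 𝓘(ℝ, ℝ) ∞ u) :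
    IsConformalCompactification g₀ (fun x ↦ Real.exp (u x) * s x) (rescale u g) where
  interior_metric := h.interior_metric
  metric := h.metric.rescale hu
  defining :=
    { smooth := (Real.contDiff_exp.contMDiff.comp hu).mul h.defining.smooth
      nonneg := fun x ↦ mul_nonneg (Real.exp_pos _).le (h.defining.nonneg x)
      zero_iff := fun x ↦ by
        rw [mul_eq_zero, or_iff_right (Real.exp_ne_zero _), h.defining.zero_iff]
      differential_ne_zero := fun x hx ↦ by
        rw [differential_exp_mul h.defining.smooth hu, (h.defining.zero_iff x).2 hx, zero_smul,
          add_zero]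
        exact smul_ne_zero (Real.exp_ne_zero _) (h.defining.differential_ne_zero x hx) }
  extends_metric x hx := by
    rw [AlmostEinstein.rescale, h.extends_metric x hx, smul_smul, mul_pow, ← Real.exp_nat_mul]
    norm_cast

omit hE hd in
/-- The defining function of a conformal compactification is determined by the metrics. -/
theorem unique {s' : M → ℝ} (h' : IsConformalCompactification g₀ s' g) : s = s' := by
  funext x
  by_cases hx : x ∈ (𝓡∂ d).interior M
  · let v : EuclideanSpace ℝ (Fin d) := EuclideanSpace.single 0 1
    have hv : v ≠ 0 := by simp [v]
    have hp : 0 < g₀ x v v := h.interior_metric.pos x hx v hv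
    have e : s x ^ 2 * g₀ x v v = s' x ^ 2 * g₀ x v v :=
      congrArg (fun B : EuclideanSpace ℝ (Fin d) →L[ℝ] EuclideanSpace ℝ (Fin d) →L[ℝ] ℝ ↦ B v v)
        ((h.extends_metric x hx).symm.trans (h'.extends_metric x hx))
    exact (sq_eq_sq₀ (h.defining.nonneg x) (h'.defining.nonneg x)).1
      (mul_right_cancel₀ hp.ne' e)
  · have hb : x ∈ (𝓡∂ d).boundary M := by rwa [← (𝓡∂ d).compl_interior]
    rw [(h.defining.zero_iff x).2 hb, (h'.defining.zero_iff x).2 hb]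

/-- The transformation of the tractor under a change of the metric in the conformal class. -/
theorem scaleTractor_rescale (hu : ContMDiff (𝓡∂ d) 𝓘(ℝ, ℝ) ∞ u) (x : M) :
    scaleTractor (AlmostEinstein.rescale u g) (fun x ↦ Real.exp (u x) * s x) x
      = changeSplitting g u (scaleTractor g s x) := by
  have hs := h.defining.smooth
  have h' := h.rescale hu
  have hg := h.metric
  have hy := mem_extChartAt_target (I := 𝓡∂ d) x
  refine SplitTractor.ext rfl (differential_exp_mul hs hu x) ?_
  -- Both tractors have length one and their top two slots already match. Where `s ≠ 0` this
  -- determines the bottom slot, and no transformation law for the curvature is needed.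
  have key : ∀ q, s q ≠ 0 →
      (scaleTractor (AlmostEinstein.rescale u g) (fun x ↦ Real.exp (u x) * s x) q).ρ
        = (changeSplitting g u (scaleTractor g s q)).ρ := fun q hq ↦ by
    have e1 := h.cometric_add hE hd q
    have e2 := h'.cometric_add hE hd q
    rw [differential_exp_mul hs hu, cometric_rescale hg hu] at e2
    have e3 : cometric (g q) (Real.exp (u q) • (differential s q + s q • differential u q))
        (Real.exp (u q) • (differential s q + s q • differential u q))
        = Real.exp (u q) ^ 2 * (cometric (g q) (differential s q) (differential s q)
          + 2 * s q * cometric (g q) (differential u q) (differential s q)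
          + s q ^ 2 * cometric (g q) (differential u q) (differential u q)) := by
      have := cometric_symm hg q (differential s q) (differential u q)
      simp only [cometric, map_smul, map_add] at this ⊢
      simp only [add_apply, smul_apply, smul_eq_mul, this]
      ring
    rw [e3] at e2
    have hexp : Real.exp (-u q) * Real.exp (u q) = 1 := by
      rw [← Real.exp_add]; simp
    change _ = Real.exp (-u q) * ((scaleTractor g s q).ρ
      - cometric (g q) (differential u q) (differential s q)
      - (1 / 2) * s q * cometric (g q) (differential u q) (differential u q))
    set a := Real.exp (-u q)
    set b := Real.exp (u q)
    set r := (scaleTractor (AlmostEinstein.rescale u g) (fun x ↦ Real.exp (u x) * s x) q).ρ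
    have hab : a ^ 2 * b ^ 2 = 1 := by rw [← mul_pow, hexp, one_pow]
    have hb : b ≠ 0 := Real.exp_ne_zero _
    -- The factor `e^u s` multiplying the new `ρ` in its length equation is cancelled.
    refine mul_left_cancel₀ (mul_ne_zero hb hq) ?_
    linear_combination e2 / 2 - e1 / 2 - (cometric (g q) (differential s q) (differential s q)
          + 2 * s q * cometric (g q) (differential u q) (differential s q)
          + s q ^ 2 * cometric (g q) (differential u q) (differential u q)) / 2 * hab
      - s q * ((scaleTractor g s q).ρ - cometric (g q) (differential u q) (differential s q)
      - (1 / 2) * s q * cometric (g q) (differential u q) (differential u q)) * hexp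
  -- Both sides are continuous, so the identity extends to the boundary.
  have hc := h.defining.eq_of_forall_ne_zero hy
    (A := fun z ↦ (scaleTractor (AlmostEinstein.rescale u g)
      (fun x ↦ Real.exp (u x) * s x) (pt x z)).ρ)
    (B := fun z ↦ (changeSplitting g u (scaleTractor g s (pt x z))).ρ) ?_ ?_ ?_
  · have e : ∀ q, q = x → (scaleTractor (AlmostEinstein.rescale u g)
        (fun x ↦ Real.exp (u x) * s x) q).ρ = (changeSplitting g u (scaleTractor g s q)).ρ →
        (scaleTractor (AlmostEinstein.rescale u g) (fun x ↦ Real.exp (u x) * s x) x).ρ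
          = (changeSplitting g u (scaleTractor g s x)).ρ := by
      rintro _ rfl
      exact id
    exact e _ (pt_extChartAt x) hc
  · exact (smoothAt_comp_pt (h'.contMDiff_rho hE hd) hy).continuousWithinAt
  · have hρ := (smoothAt_comp_pt (h.contMDiff_rho hE hd) hy).continuousWithinAt
    have hu' := (smoothAt_comp_pt hu hy).continuousWithinAt
    have hs' := (smoothAt_comp_pt hs hy).continuousWithinAt
    exact (Real.continuous_exp.continuousAt.comp_continuousWithinAt hu'.neg).mul
      ((hρ.sub (smoothAt_cometric hg hu hs hy).continuousWithinAt).sub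
        ((continuousWithinAt_const.mul hs').mul
          (smoothAt_cometric hg hu hu hy).continuousWithinAt))
  · exact Filter.Eventually.of_forall fun z hz ↦ key _ hz

end IsConformalCompactification

end MetricToScale

end AlmostEinstein

theorem mainTheorem11 (d : ℕ) [NeZero d] (hd : 3 ≤ d)
    (M : Type*) [TopologicalSpace M] [T2Space M] [CompactSpace M] [ConnectedSpace M]
    [ChartedSpace (EuclideanHalfSpace d) M] [IsManifold (𝓡∂ d) ∞ M] :
    (∀ (c : ConformalStructure d M) (T : Tractor c), T.IsAlmostEinstein →
      (∀ g x, T.normSq g x = 1) → T.singularSet = (𝓡∂ d).boundary M →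
      ∀ g : c.metrics, IsPoincareEinstein (T.scaleMetric g) ∧
        IsConformalCompactification (T.scaleMetric g) (fun x ↦ |T.scale g x|) g) ∧
    (∀ g₀ : BilinField d M, IsPoincareEinstein g₀ →
      ∀ (s : M → ℝ) (g : BilinField d M) (h : IsConformalCompactification g₀ s g),
        ∃ T : Tractor (ConformalStructure.ofMetric g h.metric),
          T.IsAlmostEinstein ∧ T.IsScalarNegative ∧ (∀ g' x, T.normSq g' x = 1) ∧
          T.singularSet = (𝓡∂ d).boundary M ∧
          ∀ g', ∀ x ∈ (𝓡∂ d).interior M, T.scaleMetric g' x = g₀ x) := by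
  refine ⟨fun c T hT hN hS g ↦ ?_, fun g₀ hg₀ s g h ↦ ?_⟩
  · have hc := hT.1.isConformalCompactification hN hS g
    exact ⟨⟨⟨_, _, hc⟩, hT.1.isNormalisedEinstein hd hN hS g⟩, hc⟩
  · have hE := hg₀.2
    -- Each metric `e^{2u} g` of the class compactifies `g₀` by `e^u s`. Uniqueness of the defining
    -- function makes the choices `S` compatible with rescaling.
    have hex : ∀ g' : (ConformalStructure.ofMetric g h.metric).metrics,
        ∃ s', IsConformalCompactification g₀ s' (g' : BilinField d M) := by
      rintro ⟨_, u, hu, rfl⟩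
      exact ⟨_, h.rescale hu⟩
    choose S hS using hex
    let T : Tractor (ConformalStructure.ofMetric g h.metric) :=
      { val := fun g' ↦ scaleTractor (g' : BilinField d M) (S g')
        val_rescale := fun g₁ g₂ u hu e x ↦ by
          have h2 := (hS g₁).rescale hu
          rw [← e] at h2
          rw [(hS g₂).unique h2, e]
          exact (hS g₁).scaleTractor_rescale hE hd hu x
        smooth_σ := fun g' ↦ (hS g').defining.smooth
        smooth_μ := fun g' ↦ contMDiff_differential (hS g').defining.smooth
        smooth_ρ := fun g' ↦ (hS g').contMDiff_rho hE hd }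
    have hscale : ∀ g', T.scale g' = S g' := fun g' ↦ funext fun x ↦ T.scale_eq g' x
    have hN : ∀ g' x, T.normSq g' x = 1 := fun g' x ↦ by
      have e := (hS g').cometric_add hE hd x
      have e' : T.normSq g' x = cometric ((g' : BilinField d M) x) (differential (S g') x)
        (differential (S g') x) + S g' x * (scaleTractor (g' : BilinField d M) (S g') x).ρ
          + (scaleTractor (g' : BilinField d M) (S g') x).ρ * S g' x := rfl
      rw [e']
      linarith
    obtain ⟨g', hg'⟩ := (ConformalStructure.ofMetric g h.metric).nonempty
    refine ⟨T, ⟨fun g' x₀ y hy i ↦ (hS g').tractorConnection_eq_zero hE hd hy i, ⟨g', hg'⟩,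
      Classical.arbitrary M, fun h0 ↦ ?_⟩, fun g' x₀ y hy ↦ ?_, hN, ?_, fun g' x hx ↦ ?_⟩
    -- A tractor of length one cannot vanish.
    · have e := hN ⟨g', hg'⟩ (Classical.arbitrary M)
      rw [Tractor.normSq, h0] at e
      simp [tractorMetric, cometric] at e
    · rw [hscale, (hS g').almostScalar_eq hE hd hy]
      norm_num
    · ext x
      rw [T.mem_singularSet_iff ⟨g', hg'⟩, hscale, (hS _).defining.zero_iff]
    · rw [Tractor.scaleMetric, hscale]
      exact (hS g').inv_smul_metric hx
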